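/- All graphs are finite and simple, and $\log$ is the natural logarithm. For a graph $H$ let $$c(H)=\inf\{c\in\mathbb R:\ \text{every graph } G \text{ with } |G|\ge 1 \text{ and } e(G)/|G|\ge c \text{ has } H \text{ as a minor}\},$$ and let $\alpha=\max_{0<p<1}\frac{p}{2\sqrt{\log(1/(1-p))}}=0.319\dots$. Let $r\ge 1$. A weight vector is $\vec\sigma=(\sigma_1,\dots,\sigma_r)\in\mathbb R_{\ge 0}^r$ with $\sum_i\sigma_i=1$. Let $\mathbf D=(D_{ij})_{i,j=1}^r$ be a symmetric matrix whose entries are real numbers at most $1$ or the formal symbol $-\infty$ (smaller than every real number, with $d^{-\infty}=0$ for $d>1$). Put $$\gamma(\vec\sigma,\mathbf D)=\min\Big\{\sum_{i}\sigma_i\beta_i:\ \beta\in\mathbb R_{\ge 0}^r,\ \beta_i\beta_j\ge D_{ij}\ \text{for all } 1\le i,j\le r\Big\}$$ (an infimum, which is attained when all $\sigma_i>0$). For an integer $t\ge 1$ and a real $d>1$, let $\mathcal D(\vec\sigma,\mathbf D)(t,d)$ be the set of all graphs $H$ with vertex set $\{1,\dots,t\}$ such that, for all $1\le i,j\le r$,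 $H$ has exactly $\lfloor t d^{D_{ij}}\rfloor$ edges between $S_i$ and $S_j$ (for $i=j$: inside $S_i$). Here $S_1=\{1,\dots,s_1\}$, $S_2=\{s_1+1,\dots,s_1+s_2\}$, and so on, where $s_i=\lfloor\sigma_i t\rfloor$ for $i\le i_0$ and $s_i=\lceil\sigma_i t\rceil$ for $i>i_0$, with $i_0\in\{0,\dots,r\}$ chosen so that $\sum_i s_i=t$ (the sizes $s_i$ do not depend on the choice of such an $i_0$). **Theorem.** For every $\epsilon>0$ there is a $D_0=D_0(\epsilon)$ such that the following holds for all integers $t$ and all real $d$ with $t>d>D_0$. Let $r\ge 1$, let $\vec\sigma$ be a weight vector of length $r$ with all $\sigma_i>\epsilon$, and let $\mathbf D$ be a symmetric $r\times r$ matrix with entries in $[-\infty,1]$ such that $\gamma(\vec\sigma,\mathbf D)\ge\epsilon$. Then all but at most a $2^{-t}$ proportion of the elements $H\in\mathcal D(\vec\sigma,\mathbf D)(t,d)$ satisfy $$c(H)\ \ge\ (\alpha-\epsilon)\,\gamma(\vec\sigma,\mathbf D)\,t\sqrt{\log d};$$ that is, the number of elements $H$ violating this inequality is at most $2^{-t}\,|\mathcal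 D(\vec\sigma,\mathbf D)(t,d)|$. -/

import Mathlib

/-- `IsMinor H G`: the graph `H` is a minor of `G`, i.e. `G` contains a model of `H`: pairwise
disjoint non-empty connected vertex sets `X h`, one for each vertex `h` of `H`, such that for every
edge `hh'` of `H` some edge of `G` joins `X h` to `X h'`.
(`SimpleGraph.Connected` includes non-emptiness.) -/
def IsMinor {W V : Type*} (H : SimpleGraph W) (G : SimpleGraph V) : Prop :=
  ∃ X : W → Set V,
    (∀ h, (G.induce (X h)).Connected) ∧
    (∀ h h', h ≠ h' → Disjoint (X h) (X h')) ∧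
    (∀ h h', H.Adj h h' → ∃ x ∈ X h, ∃ y ∈ X h', G.Adj x y)

/-- The minor extremal function
`c(H) = inf {c : every (finite, non-null) graph G with e(G)/|G| ≥ c has H as a minor}`,
where `c` ranges over the real numbers. The infimum is taken in the extended reals, so that no
default value is involved. -/
noncomputable def minorExtremal {W : Type*} (H : SimpleGraph W) : EReal :=
  sInf {x : EReal | ∃ c : ℝ, x = (c : EReal) ∧
    ∀ (n : ℕ) (G : SimpleGraph (Fin n)), 0 < n → c ≤ (G.edgeSet.ncard : ℝ) / (n : ℝ) →
      IsMinor H G}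

/-- The constant `α = max_{0<p<1} p / (2 √(log (1/(1-p)))) = 0.319…`. -/
noncomputable def alphaConst : ℝ :=
  sSup ((fun p : ℝ => p / (2 * Real.sqrt (Real.log (1 / (1 - p))))) '' Set.Ioo 0 1)

/-- A weight vector: non-negative entries with sum `1`. -/
def IsWeightVector {r : ℕ} (σ : Fin r → ℝ) : Prop :=
  (∀ i, 0 ≤ σ i) ∧ ∑ i, σ i = 1

/-- A symmetric matrix with entries in `[-∞, 1]`; the formal symbol `-∞` is `⊥ : WithBot ℝ`. -/
def IsExponentMatrix {r : ℕ} (D : Fin r → Fin r → WithBot ℝ) : Prop :=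
  (∀ i j, D i j = D j i) ∧ ∀ i j, D i j ≤ ((1 : ℝ) : WithBot ℝ)

/-- `γ(σ, D) = min {σ · β : β ≥ 0, β_i β_j ≥ D_{ij} for all i, j}`. -/
noncomputable def gammaParam {r : ℕ} (σ : Fin r → ℝ) (D : Fin r → Fin r → WithBot ℝ) : ℝ :=
  sInf {x : ℝ | ∃ β : Fin r → ℝ, (∀ i, 0 ≤ β i) ∧
    (∀ i j, D i j ≤ ((β i * β j : ℝ) : WithBot ℝ)) ∧ x = ∑ i, σ i * β i}

/-- `d ^ a` for an exponent `a` that is a real number or `-∞`, with `d ^ (-∞) = 0`. -/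
noncomputable def powBot (d : ℝ) : WithBot ℝ → ℝ
  | none => 0
  | some a => d ^ a

/-- `s_i = ⌊σ_i t⌋` for the first `i₀` indices and `s_i = ⌈σ_i t⌉` for the others. -/
noncomputable def partSize {r : ℕ} (σ : Fin r → ℝ) (t i₀ : ℕ) (i : Fin r) : ℕ :=
  if (i : ℕ) < i₀ then ⌊σ i * (t : ℝ)⌋₊ else ⌈σ i * (t : ℝ)⌉₊

/-- The blocks `S_1, S_2, …` of consecutive vertices of sizes `s_1, s_2, …`. -/
def block {r : ℕ} (s : Fin r → ℕ) (t : ℕ) (i : Fin r) : Set (Fin t) :=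
  {v | ∑ j ∈ Finset.Iio i, s j ≤ (v : ℕ) ∧ (v : ℕ) < ∑ j ∈ Finset.Iic i, s j}

/-- The number of edges of `G` with one end in `A` and the other in `B`; for `A = B` this is the
number of edges inside `A`. -/
noncomputable def edgesBetween {V : Type*} (G : SimpleGraph V) (A B : Set V) : ℕ :=
  {e ∈ G.edgeSet | ∃ x ∈ A, ∃ y ∈ B, e = s(x, y)}.ncard

/-- The class `𝒟(σ, D)(t, d)` of graphs on `t` labelled vertices: with `i₀` chosen so that the
sizes `s_i` sum to `t`, there are exactly `⌊t d ^ D_{ij}⌋` edges between `S_i` and `S_j`, for all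
`i, j`. (Different admissible choices of `i₀` give the same sizes.) -/
def graphClass {r : ℕ} (σ : Fin r → ℝ) (D : Fin r → Fin r → WithBot ℝ) (t : ℕ) (d : ℝ) :
    Set (SimpleGraph (Fin t)) :=
  {G | ∃ i₀ : ℕ, i₀ ≤ r ∧ ∑ i, partSize σ t i₀ i = t ∧
    ∀ i j, edgesBetween G (block (partSize σ t i₀) t i) (block (partSize σ t i₀) t j) =
      ⌊(t : ℝ) * powBot d (D i j)⌋₊}

/-!
The lower bound comes from one graph that serves for the whole class: if `H` violates it, then `H` is
a minor of every graph `G` that is dense enough, and a suitable such `G` contains few members of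
the class as minors.

The graph `G` is the blow-up of a random graph `G₀` with edge probability `p = 1 - q` on
`m = ⌊d⌋` vertices, each replaced by `b` independent vertices, where `m * b` is slightly below
`γ(σ, D) t L` with `L = √(log d / log (1 / q))`. For `p` nearly optimal in the definition of `α`, its
density is as required. Because of the blow-up only the projections `A h` of the branch sets
to the vertices of `G₀` matter, and there are only `exp t * m ^ (m * b)` families of them
(`card_families_le`), a bound without a factor `log t` in the exponent.

Fix such a family. As the sets `A h` have total size below `γ(σ, D) t L`, the definition of `γ` as
an infimum provides an entry `a = D i j` such that a constant proportion of the sets belonging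
to `S i` have size at most `x * L`, a constant proportion of those belonging to `S j` have size at
most `y * L`, and `x * y < a` with some room (`exists_light_blocks`). Two disjoint sets of these
sizes are non-adjacent in `G₀` with probability at least `q ^ (x * y * L ^ 2) = d ^ (-x * y)`, so one
expects at least `t ^ 2 * d ^ (δ - a)` non-adjacent pairs, up to a constant. A member `H` of the class
compatible with the family has `⌊t d ^ a⌋` edges between `S i` and `S j` and avoids all these pairs,
which holds for a proportion of at most `exp (-c t d ^ δ)` of the class
(`ncard_avoiding_le`). This beats the number of families, whose logarithm is of order
`t (log d) ^ (3 / 2)`.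

Since `t` may be far larger than `m`, a union bound over the families cannot show that `G₀` has the
expected number of non-adjacent pairs. Instead `G₀` is chosen such that all choices of `2 N`
*disjoint* sets, with `N` of order `d / log d`, have many non-adjacent pairs
(`exists_hasManyNonAdjacentPairs`). Each vertex of `G₀` lies in at most `b` of the sets `A h`, so
disjoint sets can be extracted greedily from any large subfamily, and this transfers the
property to the whole family (`card_nonAdjacent_ge`).
-/

section
open Classical
open Filter

/-! ### Random subsets -/

/-- The probability that a `q`-random subset of `α` (each element kept independently with
probability `q`) equals `T`. -/
noncomputable def subsetWeight {α : Type*} [Fintype α] (q : ℝ) (T : Finset α) : ℝ :=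
  q ^ T.card * (1 - q) ^ (Fintype.card α - T.card)

lemma subsetWeight_nonneg {α : Type*} [Fintype α] {q : ℝ} (h0 : 0 ≤ q) (h1 : q ≤ 1)
    (T : Finset α) : 0 ≤ subsetWeight q T :=
  mul_nonneg (pow_nonneg h0 _) (pow_nonneg (by linarith) _)

lemma sum_subsetWeight_superset {α : Type*} [Fintype α] [DecidableEq α] (q : ℝ) (S : Finset α) :
    ∑ T : Finset α, subsetWeight q T * (if S ⊆ T then 1 else 0) = q ^ S.card := by
  have h := Finset.prod_add (fun _ : α => q) (fun e => if e ∈ S then 0 else 1 - q) Finset.univ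
  have hl : ∏ e : α, (q + if e ∈ S then 0 else 1 - q) = q ^ S.card := by
    rw [← Finset.prod_subset (Finset.subset_univ S)]
    · rw [Finset.prod_congr rfl (g := fun _ => q)]
      · simp
      · intro x hx; simp [hx]
    · intro x _ hx; simp [hx]
  rw [hl] at h
  rw [h, Finset.powerset_univ]
  refine Finset.sum_congr rfl fun T _ => ?_
  rw [Finset.prod_const, subsetWeight]
  by_cases hST : S ⊆ T
  · rw [if_pos hST, mul_one, ← Finset.card_univ, ← Finset.card_sdiff_of_subset (Finset.subset_univ T)]
    congr 1
    rw [Finset.prod_congr rfl (g := fun _ => 1 - q)]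
    · simp
    · intro x hx
      have : x ∉ S := fun hxS => (Finset.mem_sdiff.1 hx).2 (hST hxS)
      simp [this]
  · rw [if_neg hST, mul_zero]
    obtain ⟨x, hxS, hxT⟩ := Finset.not_subset.1 hST
    rw [Finset.prod_eq_zero (i := x) (by simp [hxT]) (by simp [hxS]), mul_zero]

lemma sum_subsetWeight {α : Type*} [Fintype α] (q : ℝ) :
    ∑ T : Finset α, subsetWeight q T = 1 := by
  simpa using sum_subsetWeight_superset (α := α) q ∅

/-- For disjoint sets `E c`, the events `E c ⊆ T` are independent for a `q`-random set `T`. -/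
lemma sum_subsetWeight_prod_one_sub {α γ : Type*} [Fintype α] [DecidableEq α] (q : ℝ) (I : Finset γ)
    (E : γ → Finset α) (hE : (I : Set γ).PairwiseDisjoint E) :
    ∑ T : Finset α, subsetWeight q T * ∏ c ∈ I, (1 + -(1 / 2) * (if E c ⊆ T then 1 else 0)) =
      ∏ c ∈ I, (1 + -(1 / 2) * q ^ (E c).card) := by
  simp_rw [Finset.prod_one_add, Finset.mul_sum]
  rw [Finset.sum_comm]
  refine Finset.sum_congr rfl fun J hJ => ?_
  rw [Finset.mem_powerset] at hJ
  rw [Finset.prod_mul_distrib, Finset.prod_const, Finset.prod_pow_eq_pow_sum,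
    ← Finset.card_biUnion (fun x hx y hy hxy => hE (hJ hx) (hJ hy) hxy),
    ← sum_subsetWeight_superset q, Finset.mul_sum]
  refine Finset.sum_congr rfl fun T _ => ?_
  rw [Finset.prod_mul_distrib, Finset.prod_const, Finset.prod_ite_zero]
  simp only [Finset.biUnion_subset, Finset.prod_const_one]
  ring

/-- Chernoff bound for the number of disjoint sets `E c` contained in a `q`-random set. -/
lemma sum_subsetWeight_lower_tail {α γ : Type*} [Fintype α] [DecidableEq α] {q ρ : ℝ} (h0 : 0 ≤ q) (h1 : q ≤ 1)
    (hρ : 0 ≤ ρ) (I : Finset γ) (E : γ → Finset α) (hE : (I : Set γ).PairwiseDisjoint E)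
    (hc : ∀ c ∈ I, ρ ≤ q ^ (E c).card) :
    ∑ T : Finset α with ((I.filter fun c => E c ⊆ T).card : ℝ) < ρ * I.card / 4,
      subsetWeight q T ≤ Real.exp (-(ρ * I.card / 4)) := by
  set μ : ℝ := ρ * I.card with hμ
  have hμ0 : 0 ≤ μ := by positivity
  have hprod : ∀ T : Finset α, ∏ c ∈ I, (1 + -(1 / 2) * (if E c ⊆ T then (1 : ℝ) else 0)) =
      (1 / 2) ^ (I.filter fun c => E c ⊆ T).card := by
    intro T
    rw [← Finset.prod_const, Finset.prod_filter]
    refine Finset.prod_congr rfl fun c _ => ?_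
    split_ifs <;> norm_num
  have key : ∑ T : Finset α with ((I.filter fun c => E c ⊆ T).card : ℝ) < μ / 4,
      subsetWeight q T ≤ ∑ T : Finset α, Real.exp (μ / 4) * (subsetWeight q T *
        ∏ c ∈ I, (1 + -(1 / 2) * (if E c ⊆ T then (1 : ℝ) else 0))) := by
    rw [Finset.sum_filter]
    refine Finset.sum_le_sum fun T _ => ?_
    have hw := subsetWeight_nonneg h0 h1 T
    rw [hprod]
    split_ifs with h
    · have h2 : 1 ≤ Real.exp (μ / 4) * (1 / 2) ^ (I.filter fun c => E c ⊆ T).card := by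
        have : Real.exp (-((I.filter fun c => E c ⊆ T).card : ℝ)) ≤
            (1 / 2) ^ (I.filter fun c => E c ⊆ T).card := by
          rw [← mul_one (-((I.filter fun c => E c ⊆ T).card : ℝ)), neg_mul, ← mul_neg,
            Real.exp_nat_mul]
          refine pow_le_pow_left₀ (Real.exp_pos _).le ?_ _
          rw [Real.exp_neg, one_div]
          exact inv_anti₀ (by norm_num) (by linarith [Real.add_one_le_exp 1])
        calc (1 : ℝ) ≤ Real.exp (μ / 4) * Real.exp (-((I.filter fun c => E c ⊆ T).card : ℝ)) := by
              rw [← Real.exp_add]; exact Real.one_le_exp (by linarith)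
          _ ≤ _ := by gcongr
      nlinarith
    · positivity
  refine key.trans ?_
  rw [← Finset.mul_sum, sum_subsetWeight_prod_one_sub q I E hE]
  have h3 : ∏ c ∈ I, (1 + -(1 / 2) * q ^ (E c).card) ≤ ∏ c ∈ I, Real.exp (-(ρ / 2)) := by
    refine Finset.prod_le_prod (fun c _ => ?_) fun c hcI => ?_
    · have := pow_le_one₀ h0 h1 (n := (E c).card)
      linarith
    · have := hc c hcI
      have := Real.add_one_le_exp (-(ρ / 2))
      linarith
  calc Real.exp (μ / 4) * ∏ c ∈ I, (1 + -(1 / 2) * q ^ (E c).card)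
      ≤ Real.exp (μ / 4) * ∏ c ∈ I, Real.exp (-(ρ / 2)) := by gcongr
    _ = Real.exp (-(μ / 4)) := by
        rw [Finset.prod_const, ← Real.exp_nat_mul, ← Real.exp_add]
        congr 1; rw [hμ]; ring

/-! ### Counting families of sets -/

/-- Weighting a family by `m ^ (n - ∑ |C i|)`, with `m` the number of points, and summing over all
families gives the bound. -/
lemma card_families_le {ι V : Type*} [Fintype ι] [DecidableEq ι] [Fintype V] (hV : 0 < Fintype.card V) (n : ℕ) :
    ((Finset.univ.filter fun C : ι → Finset V => ∑ i, (C i).card ≤ n).card : ℝ) ≤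
      Real.exp (Fintype.card ι) * (Fintype.card V : ℝ) ^ n := by
  set m := Fintype.card V with hm
  have hm0 : (0 : ℝ) < m := by exact_mod_cast hV
  have h1m : (1 : ℝ) ≤ m := by exact_mod_cast hV
  let F : (ι → Finset V) → Finset (Σ _ : ι, V) := fun C => Finset.univ.sigma C
  have hF : Function.Injective F := by
    intro C C' h
    funext i
    ext v
    have := congrArg (fun S : Finset (Σ _ : ι, V) => (⟨i, v⟩ : Σ _ : ι, V) ∈ S) h
    simpa [F] using this
  have hsub : ((Finset.univ.filter fun C : ι → Finset V => ∑ i, (C i).card ≤ n).card : ℝ) ≤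
      ∑ T : Finset (Σ _ : ι, V), (m : ℝ) ^ n * ((1 / m : ℝ) ^ T.card) := by
    rw [Finset.card_eq_sum_ones, Nat.cast_sum]
    calc ∑ C : ι → Finset V with ∑ i, (C i).card ≤ n, ((1 : ℕ) : ℝ)
        ≤ ∑ C : ι → Finset V with ∑ i, (C i).card ≤ n, (m : ℝ) ^ n * ((1 / m : ℝ) ^ (F C).card) := by
          refine Finset.sum_le_sum fun C hC => ?_
          have hC' : (F C).card ≤ n := by
            simpa [F, Finset.card_sigma] using hC
          rw [Nat.cast_one, one_div, inv_pow, ← div_eq_mul_inv, le_div_iff₀ (by positivity), one_mul]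
          exact pow_le_pow_right₀ h1m hC'
      _ = ∑ T ∈ (Finset.univ.filter fun C : ι → Finset V => ∑ i, (C i).card ≤ n).image F,
            (m : ℝ) ^ n * ((1 / m : ℝ) ^ T.card) := by
          rw [Finset.sum_image (fun x _ y _ h => hF h)]
      _ ≤ _ := Finset.sum_le_sum_of_subset_of_nonneg (Finset.subset_univ _)
          fun _ _ _ => by positivity
  refine hsub.trans ?_
  have h := Fintype.sum_pow_mul_eq_add_pow (Σ _ : ι, V) (1 / m : ℝ) 1
  simp only [one_pow, mul_one] at h
  rw [← Finset.mul_sum, h, mul_comm]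
  refine mul_le_mul_of_nonneg_right ?_ (by positivity)
  have hcard : Fintype.card (Σ _ : ι, V) = Fintype.card ι * m := by simp [hm]
  rw [hcard]
  calc (1 / (m : ℝ) + 1) ^ (Fintype.card ι * m)
      ≤ (Real.exp (1 / m)) ^ (Fintype.card ι * m) := by
        gcongr; exact Real.add_one_le_exp _
    _ = Real.exp (Fintype.card ι) := by
        rw [← Real.exp_nat_mul]; congr 1; push_cast; field_simp

/-! ### Pseudo-random graphs -/

lemma sum_biUnion_le {ι β : Type*} [DecidableEq β] {f : β → ℝ} (s : Finset ι) (t : ι → Finset β)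
    (hf : ∀ x, 0 ≤ f x) : ∑ x ∈ s.biUnion t, f x ≤ ∑ i ∈ s, ∑ x ∈ t i, f x := by
  induction s using Finset.induction_on with
  | empty => simp
  | insert i s hi ih =>
    rw [Finset.biUnion_insert, Finset.sum_insert hi]
    have h1 := Finset.sum_union_inter (s₁ := t i) (s₂ := s.biUnion t) (f := f)
    have h2 : 0 ≤ ∑ x ∈ t i ∩ s.biUnion t, f x := Finset.sum_nonneg fun x _ => hf x
    linarith

/-- No edge of `G` joins `A` to `B`. The sets may overlap. -/
def NonAdjacent {V : Type*} (G : SimpleGraph V) (A B : Finset V) : Prop :=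
  ∀ v ∈ A, ∀ w ∈ B, ¬ G.Adj v w

/-- All pairs `s(v, w)` with `v ∈ A` and `w ∈ B`. -/
def crossPairs {V : Type*} [DecidableEq V] (A B : Finset V) : Finset (Sym2 V) :=
  (A ×ˢ B).image fun x => s(x.1, x.2)

lemma card_crossPairs_le {V : Type*} [DecidableEq V] (A B : Finset V) :
    (crossPairs A B).card ≤ A.card * B.card :=
  Finset.card_image_le.trans (Finset.card_product A B).le

lemma disjoint_crossPairs {ι κ V : Type*} [DecidableEq V] {C : ι ⊕ κ → Finset V}
    (hC : Pairwise fun i j => Disjoint (C i) (C j)) {x y : ι × κ} (hxy : x ≠ y) :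
    Disjoint (crossPairs (C (.inl x.1)) (C (.inr x.2)))
      (crossPairs (C (.inl y.1)) (C (.inr y.2))) := by
  rw [Finset.disjoint_left]
  intro e he he'
  simp only [crossPairs, Finset.mem_image, Finset.mem_product, Prod.exists] at he he'
  obtain ⟨v, w, ⟨hv, hw⟩, rfl⟩ := he
  obtain ⟨v', w', ⟨hv', hw'⟩, h⟩ := he'
  have hd : ∀ {i j u}, u ∈ C i → u ∈ C j → i = j := fun {i j u} hi hj => by
    by_contra hne
    exact Finset.disjoint_left.1 (hC hne) hi hj
  rcases Sym2.eq_iff.1 h with ⟨rfl, rfl⟩ | ⟨rfl, rfl⟩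
  · have h1 := hd hv hv'
    have h2 := hd hw hw'
    simp only [Sum.inl.injEq, Sum.inr.injEq] at h1 h2
    exact hxy (Prod.ext h1 h2)
  · exact absurd (hd hw hv') (by simp)

lemma nonAdjacent_of_crossPairs_subset {V : Type*} [DecidableEq V] {A B : Finset V} {T : Finset (Sym2 V)}
    (h : crossPairs A B ⊆ T) : NonAdjacent (SimpleGraph.fromEdgeSet ((T : Set (Sym2 V))ᶜ)) A B := by
  intro v hv w hw hadj
  rw [SimpleGraph.fromEdgeSet_adj] at hadj
  exact hadj.1 (h (Finset.mem_image.2 ⟨(v, w), Finset.mem_product.2 ⟨hv, hw⟩, rfl⟩))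

lemma ncard_edgeSet_fromEdgeSet_compl {V : Type*} [Fintype V] [DecidableEq V] (T : Finset (Sym2 V)) :
    ((SimpleGraph.fromEdgeSet ((T : Set (Sym2 V))ᶜ)).edgeSet.ncard : ℝ) =
      ∑ e : Sym2 V with ¬ e.IsDiag, (1 - if {e} ⊆ T then (1 : ℝ) else 0) := by
  have : (SimpleGraph.fromEdgeSet ((T : Set (Sym2 V))ᶜ)).edgeSet =
      ((Finset.univ.filter fun e : Sym2 V => ¬ e.IsDiag).filter fun e => e ∉ T : Finset _) := by
    ext e
    simp [SimpleGraph.edgeSet_fromEdgeSet, and_comm]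
  rw [this, Set.ncard_coe_finset, Finset.card_filter, Nat.cast_sum]
  refine Finset.sum_congr rfl fun e _ => ?_
  by_cases h : e ∈ T <;> simp [h]

lemma card_not_isDiag (m : ℕ) :
    ((Finset.univ.filter fun e : Sym2 (Fin m) => ¬ e.IsDiag).card : ℝ) = m * (m - 1) / 2 := by
  rw [← Nat.cast_choose_two, ← Fintype.card_subtype]
  have := Sym2.card_subtype_not_diag (α := Fin m)
  rw [Fintype.card_fin] at this
  rw [← this]

lemma sum_subsetWeight_ncard_edgeSet (m : ℕ) (q : ℝ) :
    ∑ T : Finset (Sym2 (Fin m)), subsetWeight q T *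
      ((SimpleGraph.fromEdgeSet ((T : Set (Sym2 (Fin m)))ᶜ)).edgeSet.ncard : ℝ) =
      (1 - q) * (m * (m - 1) / 2) := by
  simp_rw [ncard_edgeSet_fromEdgeSet_compl, Finset.mul_sum]
  rw [Finset.sum_comm, ← card_not_isDiag, mul_comm, ← nsmul_eq_mul, ← Finset.sum_const]
  refine Finset.sum_congr rfl fun e _ => ?_
  simp_rw [mul_sub, mul_one]
  rw [Finset.sum_sub_distrib, sum_subsetWeight, sum_subsetWeight_superset]
  simp

/-- The pseudo-randomness property of a graph on `m` vertices, whose density is about `1 - q`: among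
the `N²` pairs formed by `N` sets on the left and `N` sets on the right, all `2N` of them disjoint
and of size at most `k`, at least a quarter of the expected number are non-adjacent. Only
non-adjacency probabilities `ρ ≥ ρ₀` are considered. -/
def HasManyNonAdjacentPairs {V : Type*} (G : SimpleGraph V) (q ρ₀ : ℝ) (N k : ℕ) : Prop :=
  ∀ C : Fin N ⊕ Fin N → Finset V, (∀ i, (C i).card ≤ k) →
    (Pairwise fun i j => Disjoint (C i) (C j)) → ∀ ρ : ℝ, ρ₀ ≤ ρ →
    (∀ a b, ρ ≤ q ^ ((C (.inl a)).card * (C (.inr b)).card)) →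
    ρ * (N : ℝ) ^ 2 / 4 ≤ ((Finset.univ.filter fun c : Fin N × Fin N =>
      NonAdjacent G (C (.inl c.1)) (C (.inr c.2))).card : ℝ)

/-- The `(1 - q)`-random graph is pseudo-random and has the expected number of edges up to a factor
`1 - θ`, with positive probability. The expected number of edges is compared with the
maximum possible number, so no concentration for the number of edges is needed. -/
theorem exists_hasManyNonAdjacentPairs {q θ ρ₀ : ℝ} {m N k : ℕ} (hq0 : 0 < q) (hq1 : q < 1)
    (hθ : θ ≤ 1) (hm : 2 ≤ m)
    (h : Real.exp (2 * N) * (m : ℝ) ^ (2 * N * k) * Real.exp (-(ρ₀ * (N : ℝ) ^ 2 / 4)) <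
      θ * (1 - q)) :
    ∃ G : SimpleGraph (Fin m), (1 - θ) * (1 - q) * (m * (m - 1) / 2) ≤ (G.edgeSet.ncard : ℝ) ∧
      HasManyNonAdjacentPairs G q ρ₀ N k := by
  set M : ℝ := m * (m - 1) / 2 with hM
  have hMpos : 0 < M := by
    have : (2 : ℝ) ≤ m := by exact_mod_cast hm
    rw [hM]; apply div_pos (mul_pos _ _) <;> linarith
  let ρC : (Fin N ⊕ Fin N → Finset (Fin m)) → ℝ := fun C =>
    q ^ (Finset.univ.sup fun c : Fin N × Fin N => (C (.inl c.1)).card * (C (.inr c.2)).card)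
  let 𝓕 : Finset (Fin N ⊕ Fin N → Finset (Fin m)) := Finset.univ.filter fun C =>
    (∀ i, (C i).card ≤ k) ∧ (Pairwise fun i j => Disjoint (C i) (C j)) ∧ ρ₀ ≤ ρC C
  let E : (Fin N ⊕ Fin N → Finset (Fin m)) → Fin N × Fin N → Finset (Sym2 (Fin m)) :=
    fun C c => crossPairs (C (.inl c.1)) (C (.inr c.2))
  let bad : (Fin N ⊕ Fin N → Finset (Fin m)) → Finset (Finset (Sym2 (Fin m))) := fun C =>
    Finset.univ.filter fun T => ((Finset.univ.filter fun c => E C c ⊆ T).card : ℝ) <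
      ρC C * (Finset.univ : Finset (Fin N × Fin N)).card / 4
  let G : Finset (Sym2 (Fin m)) → SimpleGraph (Fin m) := fun T =>
    SimpleGraph.fromEdgeSet ((T : Set (Sym2 (Fin m)))ᶜ)
  have hw := fun T : Finset (Sym2 (Fin m)) => subsetWeight_nonneg hq0.le hq1.le T
  have hcardI : ((Finset.univ : Finset (Fin N × Fin N)).card : ℝ) = (N : ℝ) ^ 2 := by
    simp [sq]
  have hbadC : ∀ C ∈ 𝓕, ∑ T ∈ bad C, subsetWeight q T ≤ Real.exp (-(ρ₀ * (N : ℝ) ^ 2 / 4)) := by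
    intro C hC
    obtain ⟨-, hdis, hρ⟩ := (Finset.mem_filter.1 hC).2
    refine (sum_subsetWeight_lower_tail hq0.le hq1.le (pow_nonneg hq0.le _) Finset.univ (E C)
      (fun x _ y _ hxy => disjoint_crossPairs hdis hxy) fun c _ => ?_).trans ?_
    · exact pow_le_pow_of_le_one hq0.le hq1.le ((card_crossPairs_le _ _).trans
        (Finset.le_sup (f := fun c : Fin N × Fin N =>
          (C (.inl c.1)).card * (C (.inr c.2)).card) (Finset.mem_univ c)))
    · rw [hcardI]
      refine Real.exp_le_exp.2 (neg_le_neg ?_)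
      gcongr
  have h𝓕 : (𝓕.card : ℝ) ≤ Real.exp (2 * N) * (m : ℝ) ^ (2 * N * k) := by
    have := card_families_le (ι := Fin N ⊕ Fin N) (V := Fin m) (by simp; omega) (2 * N * k)
    simp only [Fintype.card_sum, Fintype.card_fin] at this
    push_cast at this
    rw [← two_mul] at this
    refine le_trans ?_ this
    norm_cast
    refine Finset.card_le_card fun C hC => ?_
    simp only [𝓕, Finset.mem_filter, Finset.mem_univ, true_and] at hC ⊢
    calc ∑ i, (C i).card ≤ ∑ _i : Fin N ⊕ Fin N, k := Finset.sum_le_sum fun i _ => hC.1 i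
      _ = 2 * N * k := by simp [two_mul]
  have hmass : ∑ T ∈ 𝓕.biUnion bad, subsetWeight q T < θ * (1 - q) := by
    refine lt_of_le_of_lt ?_ h
    calc ∑ T ∈ 𝓕.biUnion bad, subsetWeight q T ≤ ∑ C ∈ 𝓕, ∑ T ∈ bad C, subsetWeight q T :=
          sum_biUnion_le 𝓕 bad hw
      _ ≤ ∑ C ∈ 𝓕, Real.exp (-(ρ₀ * (N : ℝ) ^ 2 / 4)) := Finset.sum_le_sum hbadC
      _ = 𝓕.card * Real.exp (-(ρ₀ * (N : ℝ) ^ 2 / 4)) := by rw [Finset.sum_const, nsmul_eq_mul]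
      _ ≤ _ := by gcongr
  have hgood : ∃ T, T ∉ 𝓕.biUnion bad ∧ (1 - θ) * (1 - q) * M ≤ ((G T).edgeSet.ncard : ℝ) := by
    by_contra! hcon
    have hsum := sum_subsetWeight_ncard_edgeSet m q
    have hle : ∀ T : Finset (Sym2 (Fin m)), subsetWeight q T * ((G T).edgeSet.ncard : ℝ) ≤
        subsetWeight q T * ((1 - θ) * (1 - q) * M) +
          (if T ∈ 𝓕.biUnion bad then subsetWeight q T else 0) * M := by
      intro T
      have hGM : ((G T).edgeSet.ncard : ℝ) ≤ M := by
        rw [ncard_edgeSet_fromEdgeSet_compl T, hM, ← card_not_isDiag, Finset.card_eq_sum_ones,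
          Nat.cast_sum]
        refine Finset.sum_le_sum fun e _ => ?_
        split_ifs <;> simp
      have hwT := hw T
      have hnn : 0 ≤ (1 - θ) * (1 - q) * M :=
        mul_nonneg (mul_nonneg (by linarith) (by linarith)) hMpos.le
      split_ifs with hT
      · have := mul_le_mul_of_nonneg_left hGM hwT
        have := mul_nonneg hwT hnn
        linarith
      · have := mul_le_mul_of_nonneg_left (hcon T hT).le hwT
        linarith
    have hle' := Finset.sum_le_sum fun T (_ : T ∈ Finset.univ) => hle T
    rw [hsum, Finset.sum_add_distrib, ← Finset.sum_mul, ← Finset.sum_mul, sum_subsetWeight,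
      ← Finset.sum_filter, Finset.filter_mem_eq_inter, Finset.univ_inter] at hle'
    nlinarith
  obtain ⟨T, hT, hedges⟩ := hgood
  refine ⟨G T, hedges, fun C hk hdis ρ hρ hρC => ?_⟩
  rcases Nat.eq_zero_or_pos N with rfl | hN
  · simp
  have hne : (Finset.univ : Finset (Fin N × Fin N)).Nonempty := ⟨(⟨0, hN⟩, ⟨0, hN⟩), by simp⟩
  obtain ⟨c, -, hc⟩ := Finset.exists_mem_eq_sup Finset.univ hne fun c : Fin N × Fin N =>
    (C (.inl c.1)).card * (C (.inr c.2)).card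
  have hρle : ρ ≤ ρC C := by
    simp only [ρC, hc]
    exact hρC c.1 c.2
  have hT' : T ∉ bad C := fun hb => hT (Finset.mem_biUnion.2
    ⟨C, Finset.mem_filter.2 ⟨Finset.mem_univ _, hk, hdis, hρ.trans hρle⟩, hb⟩)
  simp only [bad, Finset.mem_filter, Finset.mem_univ, true_and, not_lt, hcardI] at hT'
  calc ρ * (N : ℝ) ^ 2 / 4 ≤ ρC C * (N : ℝ) ^ 2 / 4 := by gcongr
    _ ≤ _ := hT'
    _ ≤ _ := by
      norm_cast
      refine Finset.card_le_card fun c hc => ?_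
      simp only [Finset.mem_filter, Finset.mem_univ, true_and] at hc ⊢
      exact nonAdjacent_of_crossPairs_subset hc

/-! ### Families with bounded multiplicity -/

/-- Greedy choice of `N` sets of a family that are disjoint from each other and from `U`: a set of
`u` points meets at most `u * b` members of the family. -/
lemma exists_disjoint_subfamily {ι V : Type*} [DecidableEq V] {A : ι → Finset V} {k b : ℕ} {P : Finset ι}
    (hk : ∀ h ∈ P, (A h).card ≤ k) (hb : ∀ v, (P.filter fun h => v ∈ A h).card ≤ b) (N : ℕ) :
    ∀ U : Finset V, U.card * b + N * k * b < P.card →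
      ∃ g : Fin N → ι, (∀ a, g a ∈ P) ∧ (∀ a, Disjoint U (A (g a))) ∧
        Pairwise fun a a' => Disjoint (A (g a)) (A (g a')) := by
  induction N with
  | zero => exact fun U _ => ⟨Fin.elim0, fun a => a.elim0, fun a => a.elim0, fun a => a.elim0⟩
  | succ N ih =>
    intro U hU
    obtain ⟨h₀, hP, hd⟩ : ∃ h ∈ P, Disjoint U (A h) := by
      by_contra! hcon
      have hsub : P ⊆ U.biUnion fun v => P.filter fun h => v ∈ A h := by
        intro h hh
        obtain ⟨v, hv, hv'⟩ := Finset.not_disjoint_iff.1 (hcon h hh)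
        exact Finset.mem_biUnion.2 ⟨v, hv, Finset.mem_filter.2 ⟨hh, hv'⟩⟩
      have h1 := Finset.card_le_card hsub
      have h2 := Finset.card_biUnion_le_card_mul U (fun v => P.filter fun h => v ∈ A h) b
        fun v _ => hb v
      have : 0 ≤ (N + 1) * k * b := Nat.zero_le _
      omega
    have hcard : (U ∪ A h₀).card ≤ U.card + k :=
      (Finset.card_union_le _ _).trans (Nat.add_le_add_left (hk h₀ hP) _)
    obtain ⟨g, hgP, hgU, hg⟩ := ih (U ∪ A h₀) (by
      calc (U ∪ A h₀).card * b + N * k * b ≤ (U.card + k) * b + N * k * b := by gcongr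
        _ = U.card * b + (N + 1) * k * b := by ring
        _ < P.card := hU)
    refine ⟨Fin.cons h₀ g, fun a => ?_, fun a => ?_, fun a a' haa' => ?_⟩
    · refine Fin.cases ?_ (fun a => ?_) a <;> simp [hP, hgP]
    · refine Fin.cases ?_ (fun a => ?_) a
      · simpa using hd
      · simpa using (Finset.disjoint_union_left.1 (hgU a)).1
    · revert haa'
      refine Fin.cases ?_ (fun a => ?_) a <;> refine Fin.cases ?_ (fun a' => ?_) a'
      · simp
      · intro _
        simpa using (Finset.disjoint_union_left.1 (hgU a')).2
      · intro _
        simpa using (Finset.disjoint_union_left.1 (hgU a)).2.symm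
      · intro hne
        simpa using hg (fun h => hne (by rw [h]))

/-- In a pseudo-random graph, two families of sets in which no vertex occurs often have at least a
constant fraction of the expected number of non-adjacent pairs. Otherwise the sets of the first
family with few non-adjacent partners contain `N` disjoint ones, and the sets of the second
family with few non-adjacent partners among those `N` contain `N` more disjoint ones, against the
pseudo-randomness. -/
theorem card_nonAdjacent_ge {ι V : Type*} [DecidableEq V] {G : SimpleGraph V} {q ρ₀ ρ : ℝ} {N k b : ℕ}
    (hG : HasManyNonAdjacentPairs G q ρ₀ N k) {A : ι → Finset V} {P Q : Finset ι} (hN : 0 < N)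
    (hkP : ∀ h ∈ P, (A h).card ≤ k) (hkQ : ∀ h ∈ Q, (A h).card ≤ k)
    (hbP : ∀ v, (P.filter fun h => v ∈ A h).card ≤ b)
    (hbQ : ∀ v, (Q.filter fun h => v ∈ A h).card ≤ b)
    (hP : 2 * (N * k * b) < P.card) (hQ : 4 * (N * k * b) < Q.card) (hρ₀ : 0 ≤ ρ₀) (hρ : ρ₀ ≤ ρ)
    (hρA : ∀ h ∈ P, ∀ h' ∈ Q, ρ ≤ q ^ ((A h).card * (A h').card)) :
    ρ * P.card * Q.card / 16 ≤
      (((P ×ˢ Q).filter fun c => NonAdjacent G (A c.1) (A c.2)).card : ℝ) := by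
  set deg : ι → ℕ := fun h => (Q.filter fun h' => NonAdjacent G (A h) (A h')).card with hdeg
  have hρ0 : 0 ≤ ρ := hρ₀.trans hρ
  have hNR : (0 : ℝ) < N := by exact_mod_cast hN
  set P₀ := P.filter fun h => (deg h : ℝ) < ρ * Q.card / 8 with hP₀
  have hsmall : 2 * P₀.card ≤ P.card := by
    by_contra! hlt
    obtain ⟨g, hgP, -, hg⟩ := exists_disjoint_subfamily (A := A) (k := k) (b := b) (P := P₀)
      (fun h hh => hkP h (Finset.mem_filter.1 hh).1)
      (fun v => (Finset.card_le_card (Finset.filter_subset_filter _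
        (Finset.filter_subset _ _))).trans (hbP v)) N ∅ (by simp only [Finset.card_empty]; omega)
    have hgP' : ∀ a, g a ∈ P := fun a => (Finset.mem_filter.1 (hgP a)).1
    set U := Finset.univ.biUnion fun a => A (g a) with hU
    have hUcard : U.card ≤ N * k := by
      refine (Finset.card_biUnion_le_card_mul _ _ k fun a _ => hkP _ (hgP' a)).trans ?_
      simp
    set cnt : ι → ℕ := fun h' => (Finset.univ.filter fun a => NonAdjacent G (A (g a)) (A h')).card
      with hcnt
    set Q₀ := Q.filter fun h' => (cnt h' : ℝ) < ρ * N / 4 with hQ₀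
    have hQ₀card : Q₀.card ≤ 2 * (N * k * b) := by
      by_contra! hlt'
      have hUb : U.card * b ≤ N * k * b := Nat.mul_le_mul_right b hUcard
      obtain ⟨g', hgQ, hgU, hg'⟩ := exists_disjoint_subfamily (A := A) (k := k) (b := b) (P := Q₀)
        (fun h hh => hkQ h (Finset.mem_filter.1 hh).1)
        (fun v => (Finset.card_le_card (Finset.filter_subset_filter _
          (Finset.filter_subset _ _))).trans (hbQ v)) N U (by omega)
      have hgQ' : ∀ a, g' a ∈ Q := fun a => (Finset.mem_filter.1 (hgQ a)).1
      have hcross : ∀ a a', Disjoint (A (g a)) (A (g' a')) := fun a a' =>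
        Finset.disjoint_of_subset_left
          (Finset.subset_biUnion_of_mem (fun a => A (g a)) (Finset.mem_univ a)) (hgU a')
      have := hG (Sum.elim (fun a => A (g a)) fun a => A (g' a))
        (by rintro (a | a)
            · exact hkP _ (hgP' a)
            · exact hkQ _ (hgQ' a))
        (by rintro (a | a) (a' | a') hne
            · exact hg fun h => hne (by rw [h])
            · exact hcross a a'
            · exact (hcross a' a).symm
            · exact hg' fun h => hne (by rw [h]))
        ρ hρ (fun a a' => hρA _ (hgP' a) _ (hgQ' a'))
      rw [Finset.card_filter, Fintype.sum_prod_type_right] at this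
      have hlt2 : ∑ a' : Fin N, (cnt (g' a') : ℝ) < ∑ _a' : Fin N, ρ * N / 4 :=
        Finset.sum_lt_sum_of_nonempty ⟨⟨0, hN⟩, Finset.mem_univ _⟩
          fun a' _ => (Finset.mem_filter.1 (hgQ a')).2
      rw [Finset.sum_const, Finset.card_univ, Fintype.card_fin, nsmul_eq_mul] at hlt2
      have : ρ * (N : ℝ) ^ 2 / 4 ≤ ∑ a' : Fin N, (cnt (g' a') : ℝ) := by
        simp only [hcnt, Finset.card_filter]
        push_cast at this ⊢
        exact this
      nlinarith
    have hswap : ∑ a : Fin N, (deg (g a) : ℝ) = ∑ h' ∈ Q, (cnt h' : ℝ) := by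
      simp only [hdeg, hcnt, Finset.card_filter]
      push_cast
      exact Finset.sum_comm
    have hupper : ∑ a : Fin N, (deg (g a) : ℝ) < ∑ _a : Fin N, ρ * Q.card / 8 :=
      Finset.sum_lt_sum_of_nonempty ⟨⟨0, hN⟩, Finset.mem_univ _⟩
        fun a _ => (Finset.mem_filter.1 (hgP a)).2
    rw [Finset.sum_const, Finset.card_univ, Fintype.card_fin, nsmul_eq_mul] at hupper
    have hlower : ((Q \ Q₀).card : ℝ) * (ρ * N / 4) ≤ ∑ h' ∈ Q, (cnt h' : ℝ) := by
      rw [← nsmul_eq_mul, ← Finset.sum_const]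
      refine (Finset.sum_le_sum fun h' hh' => ?_).trans
        (Finset.sum_le_sum_of_subset_of_nonneg Finset.sdiff_subset fun _ _ _ => Nat.cast_nonneg _)
      obtain ⟨h1, h2⟩ := Finset.mem_sdiff.1 hh'
      by_contra hc
      exact h2 (Finset.mem_filter.2 ⟨h1, not_le.1 hc⟩)
    have hhalf : (Q.card : ℝ) / 2 ≤ (Q \ Q₀).card := by
      have h1 : (Q \ Q₀).card = Q.card - Q₀.card :=
        Finset.card_sdiff_of_subset (Finset.filter_subset _ _)
      have h2 : Q.card ≤ 2 * (Q \ Q₀).card := by omega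
      have : (Q.card : ℝ) ≤ 2 * (Q \ Q₀).card := by exact_mod_cast h2
      linarith
    have := mul_le_mul_of_nonneg_right hhalf (by positivity : 0 ≤ ρ * N / 4)
    nlinarith
  have hhalf : (P.card : ℝ) / 2 ≤ (P \ P₀).card := by
    have h1 : (P \ P₀).card = P.card - P₀.card :=
      Finset.card_sdiff_of_subset (Finset.filter_subset _ _)
    have h2 : P.card ≤ 2 * (P \ P₀).card := by omega
    have : (P.card : ℝ) ≤ 2 * (P \ P₀).card := by exact_mod_cast h2
    linarith
  have hcount : (((P ×ˢ Q).filter fun c => NonAdjacent G (A c.1) (A c.2)).card : ℝ) =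
      ∑ h ∈ P, (deg h : ℝ) := by
    rw [Finset.card_filter, Finset.sum_product]
    simp only [hdeg, Finset.card_filter]
    push_cast
    rfl
  rw [hcount]
  calc ρ * P.card * Q.card / 16 = (P.card : ℝ) / 2 * (ρ * Q.card / 8) := by ring
    _ ≤ (P \ P₀).card * (ρ * Q.card / 8) := by gcongr
    _ = ∑ h ∈ P \ P₀, ρ * Q.card / 8 := by rw [Finset.sum_const, nsmul_eq_mul]
    _ ≤ ∑ h ∈ P \ P₀, (deg h : ℝ) := by
        refine Finset.sum_le_sum fun h hh => ?_
        obtain ⟨h1, h2⟩ := Finset.mem_sdiff.1 hh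
        by_contra hc
        exact h2 (Finset.mem_filter.2 ⟨h1, not_le.1 hc⟩)
    _ ≤ _ := Finset.sum_le_sum_of_subset_of_nonneg Finset.sdiff_subset
        fun _ _ _ => Nat.cast_nonneg _

/-! ### Blow-ups and minors -/

/-- The blow-up of `G`: each vertex is replaced by `b` independent vertices. -/
def blowUp {m : ℕ} (G : SimpleGraph (Fin m)) (b : ℕ) : SimpleGraph (Fin (m * b)) :=
  G.comap fun i => (finProdFinEquiv.symm i).1

lemma two_mul_ncard_edgeSet {V : Type*} [Fintype V] (G : SimpleGraph V) :
    2 * G.edgeSet.ncard = ∑ v : V, ∑ w : V, if G.Adj v w then 1 else 0 := by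
  have h : G.edgeSet.ncard = G.edgeFinset.card := by
    rw [Set.ncard_eq_toFinset_card', SimpleGraph.edgeFinset]
  rw [h, ← SimpleGraph.sum_degrees_eq_twice_card_edges]
  refine Finset.sum_congr rfl fun v _ => ?_
  rw [← Finset.card_filter, ← SimpleGraph.card_neighborFinset_eq_degree,
    SimpleGraph.neighborFinset_eq_filter]

lemma ncard_edgeSet_blowUp {m : ℕ} (G : SimpleGraph (Fin m)) (b : ℕ) :
    (blowUp G b).edgeSet.ncard = b ^ 2 * G.edgeSet.ncard := by
  have h : 2 * (blowUp G b).edgeSet.ncard = 2 * (b ^ 2 * G.edgeSet.ncard) := by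
    rw [mul_left_comm, two_mul_ncard_edgeSet, two_mul_ncard_edgeSet]
    rw [← Equiv.sum_comp finProdFinEquiv, Fintype.sum_prod_type, Finset.mul_sum]
    refine Finset.sum_congr rfl fun v _ => ?_
    simp_rw [← Equiv.sum_comp finProdFinEquiv (fun w => if (blowUp G b).Adj _ w then 1 else 0),
      Fintype.sum_prod_type]
    simp only [blowUp, SimpleGraph.comap_adj, Equiv.symm_apply_apply, Finset.sum_const,
      Finset.card_univ, Fintype.card_fin, smul_eq_mul, ← Finset.mul_sum]
    ring
  omega

/-- The projections of the branch sets of a minor of the blow-up to the vertex set of `G`. -/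
lemma exists_projections_of_isMinor_blowUp {m b : ℕ} {W : Type*} [Fintype W] {H : SimpleGraph W}
    {G : SimpleGraph (Fin m)} (h : IsMinor H (blowUp G b)) :
    ∃ A : W → Finset (Fin m), (∀ v, (Finset.univ.filter fun h => v ∈ A h).card ≤ b) ∧
      ∀ h h', H.Adj h h' → ¬ NonAdjacent G (A h) (A h') := by
  obtain ⟨X, -, hdis, hadj⟩ := h
  refine ⟨fun h => Finset.univ.filter fun v => ∃ c : Fin b, finProdFinEquiv (v, c) ∈ X h,
    fun v => ?_, fun h h' hh hN => ?_⟩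
  · simp only [Finset.mem_filter, Finset.mem_univ, true_and]
    set P := Finset.univ.filter fun h => ∃ c : Fin b, finProdFinEquiv (v, c) ∈ X h with hP
    have hex : ∀ h : P, ∃ c : Fin b, finProdFinEquiv (v, c) ∈ X h := fun h =>
      (Finset.mem_filter.1 h.2).2
    choose f hf using hex
    have hinj : Function.Injective f := by
      intro h h' heq
      by_contra hne
      exact Set.disjoint_left.1 (hdis h h' fun e => hne (Subtype.ext e)) (hf h)
        (by rw [heq]; exact hf h')
    simpa using Fintype.card_le_of_injective f hinj
  · obtain ⟨x, hx, y, hy, hxy⟩ := hadj h h' hh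
    refine hN (finProdFinEquiv.symm x).1 ?_ (finProdFinEquiv.symm y).1 ?_ hxy
    · exact Finset.mem_filter.2 ⟨Finset.mem_univ _, (finProdFinEquiv.symm x).2, by
        rwa [Prod.mk.eta, Equiv.apply_symm_apply]⟩
    · exact Finset.mem_filter.2 ⟨Finset.mem_univ _, (finProdFinEquiv.symm y).2, by
        rwa [Prod.mk.eta, Equiv.apply_symm_apply]⟩

lemma sum_card_le_of_card_filter_mem_le {ι V : Type*} [Fintype ι] [Fintype V] [DecidableEq V] {b : ℕ}
    {A : ι → Finset V} (h : ∀ v, (Finset.univ.filter fun i => v ∈ A i).card ≤ b) :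
    ∑ i, (A i).card ≤ Fintype.card V * b := by
  calc ∑ i, (A i).card = ∑ i, ∑ v, if v ∈ A i then 1 else 0 := by simp
    _ = ∑ v, (Finset.univ.filter fun i => v ∈ A i).card := by
        rw [Finset.sum_comm]; simp only [Finset.card_filter]
    _ ≤ ∑ _v : V, b := Finset.sum_le_sum fun v _ => h v
    _ = _ := by simp

lemma isMinor_of_not_le_minorExtremal {W : Type*} {H : SimpleGraph W} {x : ℝ}
    (h : ¬ (x : EReal) ≤ minorExtremal H) {n : ℕ} (hn : 0 < n) (G : SimpleGraph (Fin n))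
    (hG : x ≤ (G.edgeSet.ncard : ℝ) / n) : IsMinor H G := by
  obtain ⟨_, ⟨c, rfl, hc⟩, hlt⟩ := sInf_lt_iff.1 (not_le.1 h)
  exact hc n G hn ((EReal.coe_lt_coe_iff.1 hlt).le.trans hG)

/-! ### Graphs with prescribed numbers of edges -/

lemma choose_mul_pow_le {a b : ℕ} (hab : a ≤ b) (K : ℕ) :
    a.choose K * b ^ K ≤ b.choose K * a ^ K := by
  induction K with
  | zero => simp
  | succ K ih =>
    have h : (a - K) * b ≤ (b - K) * a := by
      rcases le_total K a with h | h
      · zify [h, h.trans hab]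
        nlinarith
      · simp [Nat.sub_eq_zero_of_le h]
    refine Nat.le_of_mul_le_mul_right (c := K + 1) ?_ (Nat.succ_pos K)
    calc a.choose (K + 1) * b ^ (K + 1) * (K + 1)
        = (a.choose (K + 1) * (K + 1)) * b ^ (K + 1) := by ring
      _ = (a.choose K * b ^ K) * ((a - K) * b) := by rw [Nat.choose_succ_right_eq]; ring
      _ ≤ (b.choose K * a ^ K) * ((b - K) * a) := Nat.mul_le_mul ih h
      _ = (b.choose (K + 1) * (K + 1)) * a ^ (K + 1) := by rw [Nat.choose_succ_right_eq]; ring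
      _ = _ := by ring

/-- In a class of sets whose intersections with `E` can be any `K`-subset of `E`, independently of
the part outside `E`, the proportion of sets that meet `E` only in `E'` is at most
`(|E'|.choose K) / (|E|.choose K)`. -/
lemma card_filter_inter_subset_mul_choose_le {α : Type*} [DecidableEq α]
    {𝒞 : Finset (Finset α)} {E E' : Finset α} {K : ℕ}
    (h1 : ∀ F ∈ 𝒞, (F ∩ E).card = K) (h2 : ∀ F ∈ 𝒞, ∀ W ⊆ E, W.card = K → F \ E ∪ W ∈ 𝒞) :
    (𝒞.filter fun F => F ∩ E ⊆ E').card * E.card.choose K ≤ 𝒞.card * E'.card.choose K := by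
  set R := 𝒞.image fun F => F \ E with hR
  have hup : (𝒞.filter fun F => F ∩ E ⊆ E').card ≤ R.card * E'.card.choose K := by
    rw [← Finset.card_powersetCard, ← Finset.card_product]
    refine Finset.card_le_card_of_injOn (fun F => (F \ E, F ∩ E)) (fun F hF => ?_) ?_
    · obtain ⟨hF, hsub⟩ := Finset.mem_filter.1 hF
      exact Finset.mem_product.2 ⟨Finset.mem_image_of_mem _ hF,
        Finset.mem_powersetCard.2 ⟨hsub, h1 F hF⟩⟩
    · intro F _ F' _ h
      obtain ⟨ha, hb⟩ := Prod.ext_iff.1 h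
      simp only at ha hb
      rw [← Finset.sdiff_union_inter F E, ha, hb, Finset.sdiff_union_inter]
  have hlow : R.card * E.card.choose K ≤ 𝒞.card := by
    rw [← Finset.card_powersetCard, ← Finset.card_product]
    have hdis : ∀ x ∈ R, Disjoint x E := by
      intro x hx
      obtain ⟨F, -, rfl⟩ := Finset.mem_image.1 hx
      exact Finset.sdiff_disjoint
    refine Finset.card_le_card_of_injOn (fun x => x.1 ∪ x.2) (fun x hx => ?_) ?_
    · obtain ⟨hx1, hx2⟩ := Finset.mem_product.1 hx
      obtain ⟨F, hF, hFx⟩ := Finset.mem_image.1 hx1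
      obtain ⟨hsub, hcard⟩ := Finset.mem_powersetCard.1 hx2
      have := h2 F hF _ hsub hcard
      rwa [hFx] at this
    · rintro ⟨x, y⟩ hx ⟨x', y'⟩ hx' h
      obtain ⟨hx1, hx2⟩ := Finset.mem_product.1 hx
      obtain ⟨hx1', hx2'⟩ := Finset.mem_product.1 hx'
      have hy := (Finset.mem_powersetCard.1 hx2).1
      have hy' := (Finset.mem_powersetCard.1 hx2').1
      have hd := Finset.disjoint_left.1 (hdis _ hx1)
      have hd' := Finset.disjoint_left.1 (hdis _ hx1')
      simp only [Finset.ext_iff, Finset.mem_union] at h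
      refine Prod.ext (Finset.ext fun e => ?_) (Finset.ext fun e => ?_)
      · have := h e; have := @hd e; have := @hd' e; have := @hy e; have := @hy' e
        simp only at *
        tauto
      · have := h e; have := @hd e; have := @hd' e; have := @hy e; have := @hy' e
        simp only at *
        tauto
  calc _ ≤ R.card * E'.card.choose K * E.card.choose K := Nat.mul_le_mul_right _ hup
    _ = R.card * E.card.choose K * E'.card.choose K := by ring
    _ ≤ _ := Nat.mul_le_mul_right _ hlow

lemma card_filter_inter_subset_le {α : Type*} [DecidableEq α]
    {𝒞 : Finset (Finset α)} {E E' : Finset α} {K : ℕ} (hE : E' ⊆ E)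
    (h1 : ∀ F ∈ 𝒞, (F ∩ E).card = K) (h2 : ∀ F ∈ 𝒞, ∀ W ⊆ E, W.card = K → F \ E ∪ W ∈ 𝒞) :
    ((𝒞.filter fun F => F ∩ E ⊆ E').card : ℝ) ≤
      Real.exp (-(K * ((E \ E').card / E.card))) * 𝒞.card := by
  rcases 𝒞.eq_empty_or_nonempty with rfl | ⟨F, hF⟩
  · simp
  have hK : K ≤ E.card := by
    rw [← h1 F hF]
    exact Finset.card_le_card Finset.inter_subset_right
  rcases Nat.eq_zero_or_pos E.card with h0 | hpos
  · simp only [h0, Nat.cast_zero, div_zero, mul_zero, neg_zero, Real.exp_zero, one_mul]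
    exact_mod_cast Finset.card_le_card (Finset.filter_subset _ _)
  have hM : (0 : ℝ) < E.card := by exact_mod_cast hpos
  have hch : (0 : ℝ) < E.card.choose K := by exact_mod_cast Nat.choose_pos hK
  have hA : ((𝒞.filter fun F => F ∩ E ⊆ E').card : ℝ) * E.card.choose K ≤
      𝒞.card * E'.card.choose K := by
    exact_mod_cast card_filter_inter_subset_mul_choose_le h1 h2
  have hB : (E'.card.choose K : ℝ) * (E.card : ℝ) ^ K ≤ E.card.choose K * (E'.card : ℝ) ^ K := by
    exact_mod_cast choose_mul_pow_le (Finset.card_le_card hE) K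
  have hC : (E'.card : ℝ) / E.card ≤ Real.exp (-((E \ E').card / E.card)) := by
    have hsub : (E'.card : ℝ) = E.card - (E \ E').card := by
      have := Finset.card_sdiff_add_card_eq_card hE
      have : ((E \ E').card : ℝ) + E'.card = E.card := by exact_mod_cast this
      linarith
    rw [hsub, sub_div, div_self hM.ne']
    have := Real.add_one_le_exp (-(((E \ E').card : ℝ) / E.card))
    linarith
  have hD : ((E'.card : ℝ) / E.card) ^ K ≤ Real.exp (-(K * ((E \ E').card / E.card))) := by
    rw [← mul_neg, Real.exp_nat_mul]
    exact pow_le_pow_left₀ (by positivity) hC K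
  have hB' : (E'.card.choose K : ℝ) ≤ E.card.choose K * ((E'.card : ℝ) / E.card) ^ K := by
    rw [div_pow, mul_div_assoc', le_div_iff₀ (by positivity)]
    exact hB
  refine le_of_mul_le_mul_right ?_ hch
  calc _ ≤ (𝒞.card : ℝ) * E'.card.choose K := hA
    _ ≤ 𝒞.card * (E.card.choose K * Real.exp (-(K * ((E \ E').card / E.card)))) := by
        gcongr
        exact hB'.trans (by gcongr)
    _ = _ := by ring

/-- Among the graphs with prescribed numbers `κ i j` of edges between disjoint sets `S i` and `S j`,
the proportion of those avoiding a given set `Z` of pairs between `S i` and `S j`. -/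
theorem ncard_avoiding_le {ι V : Type*} [Fintype V] {S : ι → Set V}
    (hS : Pairwise fun i j => Disjoint (S i) (S j)) {κ : ι → ι → ℕ} (hκ : ∀ i j, κ i j = κ j i)
    (i j : ι) {Z : Finset (V × V)} (hZ : ∀ c ∈ Z, c.1 ∈ S i ∧ c.2 ∈ S j ∧ c.1 ≠ c.2)
    (hinj : Set.InjOn (fun c : V × V => s(c.1, c.2)) Z) :
    ({G : SimpleGraph V | (∀ i j, edgesBetween G (S i) (S j) = κ i j) ∧
        ∀ c ∈ Z, ¬ G.Adj c.1 c.2}.ncard : ℝ) ≤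
      Real.exp (-(κ i j * (Z.card / (Fintype.card V : ℝ) ^ 2))) *
        ({G : SimpleGraph V | ∀ i j, edgesBetween G (S i) (S j) = κ i j}.ncard : ℝ) := by
  set 𝒢 : Set (SimpleGraph V) := {G | ∀ i j, edgesBetween G (S i) (S j) = κ i j} with h𝒢
  let Φ : SimpleGraph V → Finset (Sym2 V) := fun G => G.edgeSet.toFinset
  have hΦ : Function.Injective Φ := fun G G' h => by
    have : G.edgeSet = G'.edgeSet := by simpa [Φ] using h
    exact SimpleGraph.edgeSet_inj.1 this
  let btw : ι → ι → Sym2 V → Prop := fun i j e => ∃ x ∈ S i, ∃ y ∈ S j, e = s(x, y)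
  have hbtw : ∀ {i j i' j' : ι} {e : Sym2 V}, btw i j e → btw i' j' e →
      (i' = i ∧ j' = j) ∨ (i' = j ∧ j' = i) := by
    rintro i j i' j' e ⟨x, hx, y, hy, rfl⟩ ⟨x', hx', y', hy', h⟩
    have hd : ∀ {i j u}, u ∈ S i → u ∈ S j → i = j := fun {i j u} hi hj => by
      by_contra hne
      exact Set.disjoint_left.1 (hS hne) hi hj
    rcases Sym2.eq_iff.1 h with ⟨rfl, rfl⟩ | ⟨rfl, rfl⟩
    · exact .inl ⟨hd hx' hx, hd hy' hy⟩
    · exact .inr ⟨hd hx' hy, hd hy' hx⟩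
  have hbtw_symm : ∀ {i j : ι} {e : Sym2 V}, btw i j e → btw j i e := by
    rintro i j e ⟨x, hx, y, hy, rfl⟩
    exact ⟨y, hy, x, hx, Sym2.eq_swap⟩
  set E : Finset (Sym2 V) := Finset.univ.filter fun e => ¬ e.IsDiag ∧ btw i j e with hE
  set Z' : Finset (Sym2 V) := Z.image fun c => s(c.1, c.2) with hZ'
  have hZ'E : Z' ⊆ E := by
    intro e he
    obtain ⟨c, hc, rfl⟩ := Finset.mem_image.1 he
    obtain ⟨h1, h2, h3⟩ := hZ c hc
    exact Finset.mem_filter.2 ⟨Finset.mem_univ _, by simpa using h3, c.1, h1, c.2, h2, rfl⟩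
  have hZcard : Z'.card = Z.card := Finset.card_image_of_injOn hinj
  have hEcard : E.card ≤ Fintype.card V ^ 2 := by
    calc E.card ≤ ((Finset.univ : Finset (V × V)).image fun c => s(c.1, c.2)).card := by
          refine Finset.card_le_card fun e he => ?_
          obtain ⟨-, -, x, -, y, -, rfl⟩ := Finset.mem_filter.1 he
          exact Finset.mem_image.2 ⟨(x, y), Finset.mem_univ _, rfl⟩
      _ ≤ _ := by
          refine Finset.card_image_le.trans ?_
          simp [sq]
  set 𝒞 : Finset (Finset (Sym2 V)) := (Set.toFinite (Φ '' 𝒢)).toFinset with h𝒞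
  have hmem : ∀ F, F ∈ 𝒞 ↔ ∃ G ∈ 𝒢, Φ G = F := by
    intro F; simp [h𝒞]
  have h1 : ∀ F ∈ 𝒞, (F ∩ E).card = κ i j := by
    intro F hF
    obtain ⟨G, hG, rfl⟩ := (hmem F).1 hF
    rw [← hG i j, edgesBetween, ← Set.ncard_coe_finset]
    congr 1
    ext e
    simp only [Φ, hE, Finset.coe_inter, Set.coe_toFinset, Finset.coe_filter, Finset.mem_univ,
      true_and, Set.mem_inter_iff, Set.mem_ofPred_eq, btw]
    constructor
    · exact fun h => ⟨h.1, h.2.2⟩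
    · exact fun h => ⟨h.1, G.not_isDiag_of_mem_edgeSet h.1, h.2⟩
  have h2 : ∀ F ∈ 𝒞, ∀ W ⊆ E, W.card = κ i j → F \ E ∪ W ∈ 𝒞 := by
    intro F hF W hW hWcard
    obtain ⟨G, hG, rfl⟩ := (hmem F).1 hF
    have hedge : (SimpleGraph.fromEdgeSet (↑(Φ G \ E ∪ W) : Set (Sym2 V))).edgeSet =
        (↑(Φ G \ E ∪ W) : Set (Sym2 V)) := by
      rw [SimpleGraph.edgeSet_fromEdgeSet, sdiff_eq_left, Set.disjoint_left]
      intro e he hdiag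
      rcases Finset.mem_union.1 (Finset.mem_coe.1 he) with h | h
      · have : e ∈ G.edgeSet := by simpa [Φ] using (Finset.mem_sdiff.1 h).1
        exact G.not_isDiag_of_mem_edgeSet this hdiag
      · exact (Finset.mem_filter.1 (hW h)).2.1 hdiag
    refine (hmem _).2 ⟨SimpleGraph.fromEdgeSet (↑(Φ G \ E ∪ W) : Set (Sym2 V)), fun i' j' => ?_,
      ?_⟩
    · rw [edgesBetween, hedge]
      by_cases hij : (i' = i ∧ j' = j) ∨ (i' = j ∧ j' = i)
      · have hκ' : κ i' j' = κ i j := by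
          rcases hij with ⟨rfl, rfl⟩ | ⟨rfl, rfl⟩
          · rfl
          · exact hκ _ _
        rw [hκ', ← hWcard, ← Set.ncard_coe_finset]
        have hiff : ∀ e, btw i' j' e ↔ btw i j e := by
          rcases hij with ⟨rfl, rfl⟩ | ⟨rfl, rfl⟩
          · exact fun e => Iff.rfl
          · exact fun e => ⟨hbtw_symm, hbtw_symm⟩
        congr 1
        ext e
        constructor
        · rintro ⟨he, hb⟩
          rcases Finset.mem_union.1 (Finset.mem_coe.1 he) with h | h
          · exfalso
            obtain ⟨h3, h4⟩ := Finset.mem_sdiff.1 h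
            refine h4 (Finset.mem_filter.2 ⟨Finset.mem_univ _, ?_, (hiff e).1 hb⟩)
            exact G.not_isDiag_of_mem_edgeSet (by simpa [Φ] using h3)
          · exact h
        · intro he
          exact ⟨Finset.mem_coe.2 (Finset.mem_union_right _ he),
            (hiff e).2 (Finset.mem_filter.1 (hW he)).2.2⟩
      · rw [← hG i' j', edgesBetween]
        congr 1
        ext e
        simp only [Finset.coe_union, Finset.coe_sdiff, Set.mem_ofPred_eq, Set.mem_union,
          Set.mem_sdiff, Finset.mem_coe]
        refine and_congr_left fun hb => ?_
        have heE : e ∉ E := fun he => hij (hbtw (Finset.mem_filter.1 he).2.2 hb)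
        have heW : e ∉ W := fun he => heE (hW he)
        simp [heE, heW, Φ]
    · apply Finset.coe_injective
      simp only [Φ, Set.coe_toFinset] at hedge ⊢
      exact hedge
  have hmain := card_filter_inter_subset_le (E' := E \ Z') Finset.sdiff_subset h1 h2
  rw [Finset.sdiff_sdiff_eq_self hZ'E, hZcard] at hmain
  have h𝒢card : (𝒢.ncard : ℝ) = 𝒞.card := by
    rw [← Set.ncard_image_of_injective 𝒢 hΦ, h𝒞, Set.ncard_eq_toFinset_card _ (Set.toFinite _)]
  have hbad : ({G : SimpleGraph V | (∀ i j, edgesBetween G (S i) (S j) = κ i j) ∧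
      ∀ c ∈ Z, ¬ G.Adj c.1 c.2}.ncard : ℝ) ≤
      ((𝒞.filter fun F => F ∩ E ⊆ E \ Z').card : ℝ) := by
    rw [← Set.ncard_image_of_injective _ hΦ, ← Set.ncard_coe_finset]
    refine Nat.cast_le.2 (Set.ncard_le_ncard ?_ (Finset.finite_toSet _))
    rintro _ ⟨G, ⟨hG, hGZ⟩, rfl⟩
    refine Finset.mem_coe.2 (Finset.mem_filter.2 ⟨(hmem _).2 ⟨G, hG, rfl⟩, fun e he => ?_⟩)
    obtain ⟨he1, he2⟩ := Finset.mem_inter.1 he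
    refine Finset.mem_sdiff.2 ⟨he2, fun heZ => ?_⟩
    obtain ⟨c, hc, rfl⟩ := Finset.mem_image.1 heZ
    exact hGZ c hc (by simpa [Φ] using he1)
  rw [h𝒢card]
  refine hbad.trans (hmain.trans ?_)
  refine mul_le_mul_of_nonneg_right (Real.exp_le_exp.2 (neg_le_neg ?_)) (Nat.cast_nonneg _)
  refine mul_le_mul_of_nonneg_left ?_ (Nat.cast_nonneg _)
  rcases Nat.eq_zero_or_pos E.card with h0 | hpos
  · have : Z.card = 0 := by
      rw [← hZcard]
      exact Nat.eq_zero_of_le_zero (h0 ▸ Finset.card_le_card hZ'E)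
    simp [this]
  · have : (0 : ℝ) < E.card := by exact_mod_cast hpos
    have : (E.card : ℝ) ≤ (Fintype.card V : ℝ) ^ 2 := by exact_mod_cast hEcard
    gcongr

/-! ### Blocks and the parameter `γ` -/

lemma disjoint_block {r : ℕ} (s : Fin r → ℕ) (t : ℕ) :
    Pairwise fun i j => Disjoint (block s t i) (block s t j) := by
  have key : ∀ i j : Fin r, i < j → Disjoint (block s t i) (block s t j) := by
    intro i j hij
    rw [Set.disjoint_left]
    rintro v ⟨-, h1⟩ ⟨h2, -⟩
    have : ∑ l ∈ Finset.Iic i, s l ≤ ∑ l ∈ Finset.Iio j, s l :=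
      Finset.sum_le_sum_of_subset fun l hl =>
        Finset.mem_Iio.2 ((Finset.mem_Iic.1 hl).trans_lt hij)
    omega
  intro i j hij
  rcases lt_or_gt_of_ne hij with h | h
  · exact key i j h
  · exact (key j i h).symm

lemma card_block {r : ℕ} {s : Fin r → ℕ} {t : ℕ} (hs : ∑ i, s i = t) (i : Fin r) :
    (Finset.univ.filter fun v => v ∈ block s t i).card = s i := by
  have hsum : ∑ l ∈ Finset.Iic i, s l = ∑ l ∈ Finset.Iio i, s l + s i := by
    rw [← Finset.Iio_insert, Finset.sum_insert (by simp), add_comm]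
  have hle : ∑ l ∈ Finset.Iic i, s l ≤ t := by
    rw [← hs]
    exact Finset.sum_le_sum_of_subset (Finset.subset_univ _)
  have hmap : (Finset.univ.filter fun v => v ∈ block s t i).map Fin.valEmbedding =
      Finset.Ico (∑ l ∈ Finset.Iio i, s l) (∑ l ∈ Finset.Iic i, s l) := by
    ext x
    constructor
    · intro hx
      obtain ⟨v, hv, rfl⟩ := Finset.mem_map.1 hx
      exact Finset.mem_Ico.2 (Finset.mem_filter.1 hv).2
    · intro hx
      have hx' := Finset.mem_Ico.1 hx
      exact Finset.mem_map.2 ⟨⟨x, by omega⟩, Finset.mem_filter.2 ⟨Finset.mem_univ _, hx'⟩, rfl⟩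
  rw [← Finset.card_map Fin.valEmbedding, hmap, Nat.card_Ico, hsum]
  omega

lemma gammaParam_le {r : ℕ} {σ : Fin r → ℝ} {D : Fin r → Fin r → WithBot ℝ}
    (hσ : ∀ i, 0 ≤ σ i) {β : Fin r → ℝ} (hβ : ∀ i, 0 ≤ β i)
    (hD : ∀ i j, D i j ≤ ((β i * β j : ℝ) : WithBot ℝ)) : gammaParam σ D ≤ ∑ i, σ i * β i := by
  refine csInf_le ⟨0, ?_⟩ ⟨β, hβ, hD, rfl⟩
  rintro _ ⟨β, hβ, -, rfl⟩
  exact Finset.sum_nonneg fun i _ => mul_nonneg (hσ i) (hβ i)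

lemma gammaParam_le_one {r : ℕ} {σ : Fin r → ℝ} {D : Fin r → Fin r → WithBot ℝ}
    (hσ : IsWeightVector σ) (hD : IsExponentMatrix D) : gammaParam σ D ≤ 1 := by
  simpa [hσ.2] using gammaParam_le hσ.1 (β := fun _ => 1) (fun _ => zero_le_one)
    (by simpa using hD.2)

/-- Markov's inequality for the number of elements whose weight is at most the average plus
`η / 2`. -/
lemma card_filter_le_average {α : Type*} {S : Finset α} {w : α → ℝ} (hw : ∀ h, 0 ≤ w h)
    {β η : ℝ} (hη : 0 < η) (hβ : 0 ≤ β) (hsum : ∑ h ∈ S, w h = β * S.card)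
    (hβη : (β + η) * η ≤ 1) :
    η ^ 2 / 2 * S.card ≤ ((S.filter fun h => w h ≤ β + η / 2).card : ℝ) := by
  set P := S.filter fun h => w h ≤ β + η / 2 with hP
  have h1 : ((S \ P).card : ℝ) * (β + η / 2) ≤ β * S.card := by
    rw [← hsum, ← nsmul_eq_mul, ← Finset.sum_const]
    refine (Finset.sum_le_sum fun h hh => ?_).trans
      (Finset.sum_le_sum_of_subset_of_nonneg Finset.sdiff_subset fun h _ _ => hw h)
    obtain ⟨h2, h3⟩ := Finset.mem_sdiff.1 hh
    by_contra hc
    exact h3 (Finset.mem_filter.2 ⟨h2, (not_le.1 hc).le⟩)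
  have h2 : ((S \ P).card : ℝ) + P.card = S.card := by
    exact_mod_cast Finset.card_sdiff_add_card_eq_card (Finset.filter_subset _ _ : P ⊆ S)
  have hS : (0 : ℝ) ≤ S.card := Nat.cast_nonneg _
  -- The number of light elements is at least `(η / 2) / (β + η / 2)` times the size of `S`.
  have h3 : η / 2 * S.card ≤ P.card * (β + η / 2) := by nlinarith
  have h4 := mul_le_mul_of_nonneg_right h3 hη.le
  have hPn : (0 : ℝ) ≤ P.card := Nat.cast_nonneg _
  nlinarith [mul_nonneg hPn hη.le, mul_nonneg hPn (sub_nonneg.2 hβη), mul_nonneg hPn (sq_nonneg η)]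

/-- If the weights `w` are too small on average for `γ(σ, D)`, then some entry `a = D i j` exceeds
the product of thresholds `x` and `y` such that a constant proportion of `S i` has weight at most
`x` and a constant proportion of `S j` has weight at most `y`. -/
lemma exists_light_blocks {r : ℕ} {α : Type*} [Fintype α] {σ : Fin r → ℝ}
    {D : Fin r → Fin r → WithBot ℝ} (hσ : IsWeightVector σ) (hD : IsExponentMatrix D)
    {S : Fin r → Finset α} (hS : Pairwise fun i j => Disjoint (S i) (S j))
    (hS0 : ∀ i, 0 < (S i).card) {w : α → ℝ} (hw : ∀ h, 0 ≤ w h) {c η : ℝ} (hη : 0 < η)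
    (hc : 0 ≤ c) (hσS : ∀ i, σ i ≤ c * (S i).card)
    (hγ : c * ∑ h, w h + η < gammaParam σ D) :
    ∃ (i j : Fin r) (a x y : ℝ), D i j = (a : WithBot ℝ) ∧ a ≤ 1 ∧ 0 ≤ x ∧ 0 ≤ y ∧
      (x + η / 2) * (y + η / 2) < a ∧
      η ^ 2 / 2 * (S i).card ≤ (((S i).filter fun h => w h ≤ x).card : ℝ) ∧
      η ^ 2 / 2 * (S j).card ≤ (((S j).filter fun h => w h ≤ y).card : ℝ) := by
  set β : Fin r → ℝ := fun i => (∑ h ∈ S i, w h) / (S i).card with hβ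
  have hcard : ∀ i, (0 : ℝ) < (S i).card := fun i => by exact_mod_cast hS0 i
  have hβ0 : ∀ i, 0 ≤ β i := fun i =>
    div_nonneg (Finset.sum_nonneg fun h _ => hw h) (hcard i).le
  have hβsum : ∀ i, ∑ h ∈ S i, w h = β i * (S i).card := fun i =>
    (div_mul_cancel₀ _ (hcard i).ne').symm
  have hlt : ∑ i, σ i * (β i + η) < gammaParam σ D := by
    refine lt_of_le_of_lt ?_ hγ
    simp_rw [mul_add]
    rw [Finset.sum_add_distrib, ← Finset.sum_mul, hσ.2, one_mul]
    gcongr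
    calc ∑ i, σ i * β i ≤ ∑ i, c * ∑ h ∈ S i, w h := by
          refine Finset.sum_le_sum fun i _ => ?_
          rw [hβsum, mul_left_comm, mul_comm]
          exact mul_le_mul_of_nonneg_left (hσS i) (hβ0 i)
      _ = c * ∑ h ∈ Finset.univ.biUnion S, w h := by
          rw [← Finset.mul_sum, Finset.sum_biUnion fun i _ j _ hij => hS hij]
      _ ≤ c * ∑ h, w h := mul_le_mul_of_nonneg_left
          (Finset.sum_le_sum_of_subset_of_nonneg (Finset.subset_univ _) fun h _ _ => hw h) hc
  obtain ⟨i, j, hij⟩ : ∃ i j, ¬ D i j ≤ (((β i + η) * (β j + η) : ℝ) : WithBot ℝ) := by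
    by_contra! hcon
    exact not_lt.2 (gammaParam_le hσ.1 (fun i => add_nonneg (hβ0 i) hη.le) hcon) hlt
  have hne : D i j ≠ ⊥ := fun h => hij (by rw [h]; exact bot_le)
  obtain ⟨a, ha⟩ := WithBot.ne_bot_iff_exists.1 hne
  have ha1 : a ≤ 1 := by
    have := hD.2 i j
    rw [← ha] at this
    exact WithBot.coe_le_coe.1 this
  have hlta : (β i + η) * (β j + η) < a := by
    rw [← ha] at hij
    exact not_le.1 fun h => hij (WithBot.coe_le_coe.2 h)
  have h1 : (β i + η) * η ≤ 1 := by nlinarith [hβ0 i, hβ0 j, mul_nonneg (hβ0 i) (hβ0 j)]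
  have h2 : (β j + η) * η ≤ 1 := by nlinarith [hβ0 i, hβ0 j, mul_nonneg (hβ0 i) (hβ0 j)]
  refine ⟨i, j, a, β i + η / 2, β j + η / 2, ha.symm, ha1, by linarith [hβ0 i], by linarith [hβ0 j],
    ?_, card_filter_le_average hw hη (hβ0 i) (hβsum i) h1,
    card_filter_le_average hw hη (hβ0 j) (hβsum j) h2⟩
  calc _ = (β i + η) * (β j + η) := by ring
    _ < a := hlta

lemma exists_disjoint_subsets_card_eq {α : Type*} {P Q : Finset α} {n : ℕ} (hP : 2 * n ≤ P.card)
    (hQ : 2 * n ≤ Q.card) :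
    ∃ P' ⊆ P, ∃ Q' ⊆ Q, Disjoint P' Q' ∧ P'.card = n ∧ Q'.card = n := by
  obtain ⟨P', hP', hPn⟩ := Finset.exists_subset_card_eq (show n ≤ P.card by omega)
  obtain ⟨Q', hQ', hQn⟩ := Finset.exists_subset_card_eq (show n ≤ (Q \ P').card by
    have := Finset.le_card_sdiff P' Q
    omega)
  refine ⟨P', hP', Q', hQ'.trans Finset.sdiff_subset, ?_, hPn, hQn⟩
  exact Finset.disjoint_of_subset_right hQ' Finset.disjoint_sdiff

/-! ### Few graphs of the class are minors of the blow-up -/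

lemma le_partSize {r : ℕ} {σ : Fin r → ℝ} (t i₀ : ℕ) (i : Fin r) :
    σ i * t - 1 ≤ (partSize σ t i₀ i : ℝ) := by
  unfold partSize
  split_ifs
  · exact (Nat.sub_one_lt_floor _).le
  · linarith [Nat.le_ceil (σ i * (t : ℝ))]

lemma half_le_natFloor {x : ℝ} (hx : 1 ≤ x) : x / 2 ≤ (⌊x⌋₊ : ℝ) := by
  have h1 : (1 : ℝ) ≤ ⌊x⌋₊ := by exact_mod_cast (Nat.one_le_floor_iff x).2 hx
  linarith [Nat.lt_floor_add_one x]

lemma pow_eq_exp_mul_log {x : ℝ} (hx : 0 < x) (n : ℕ) : x ^ n = Real.exp (n * Real.log x) := by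
  rw [Real.exp_nat_mul, Real.exp_log hx]

lemma rpow_neg_le_pow_of_le {d q L z : ℝ} {n : ℕ} (hd : 1 < d) (hq : 0 < q) (hq1 : q < 1)
    (hL : L ^ 2 * -Real.log q = Real.log d) (hn : (n : ℝ) ≤ z * L ^ 2) :
    d ^ (-z) ≤ q ^ n := by
  have hlog : Real.log q < 0 := Real.log_neg hq hq1
  rw [Real.rpow_def_of_pos (by linarith), pow_eq_exp_mul_log hq, ← hL]
  refine Real.exp_le_exp.2 ?_
  nlinarith

lemma threshold_bounds {x y a η : ℝ} (hη : 0 < η) (hx : 0 ≤ x) (hy : 0 ≤ y)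
    (hxy : (x + η / 2) * (y + η / 2) < a) (ha : a ≤ 1) :
    0 < a ∧ x * η ≤ 2 ∧ y * η ≤ 2 ∧ x * y ≤ a - η ^ 2 / 4 := by
  have h1 := mul_nonneg hx hη.le
  have h2 := mul_nonneg hy hη.le
  have h3 := mul_nonneg hx hy
  have h4 := mul_pos hη hη
  refine ⟨?_, ?_, ?_, ?_⟩ <;> nlinarith

/-- The proportion of graphs compatible with a given family `A` of projections of branch sets: some
pair of blocks has at least `d ^ (-a + η² / 4)` times a constant of its pairs non-adjacent, where
`a = D i j`, while about `t * d ^ a` edges are chosen there. The unit of size is `L`, so that two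
sets of sizes `x * L` and `y * L` are non-adjacent with probability `d ^ (-x * y)`. -/
theorem ncard_compatible_le {r m t N k b n : ℕ} {σ : Fin r → ℝ} {D : Fin r → Fin r → WithBot ℝ}
    (hσ : IsWeightVector σ) (hD : IsExponentMatrix D) {s : Fin r → ℕ} (hs : ∑ i, s i = t)
    {d q L η c κ₀ : ℝ} (hd : 1 < d) (ht : 0 < t) (hq : 0 < q) (hq1 : q < 1) (hL0 : 0 < L)
    (hL : L ^ 2 * -Real.log q = Real.log d) (hη : 0 < η) {G : SimpleGraph (Fin m)}
    (hG : HasManyNonAdjacentPairs G q (d ^ (η ^ 2 / 4 - 1)) N k) (hN : 0 < N)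
    (hk : 2 * L / η < k + 1) (hc : 0 ≤ c) (hσs : ∀ i, σ i ≤ c * s i)
    (hγ : c * (m * b / L) + η < gammaParam σ D) (hn : 4 * (N * k * b) < n)
    (hns : ∀ i, 2 * (n : ℝ) ≤ η ^ 2 / 2 * s i) (hκ₀ : 0 ≤ κ₀) (hκn : κ₀ * t ≤ n)
    {A : Fin t → Finset (Fin m)}
    (hA : ∀ v, (Finset.univ.filter fun h => v ∈ A h).card ≤ b) :
    ({H : SimpleGraph (Fin t) | (∀ i j, edgesBetween H (block s t i) (block s t j) =
        ⌊(t : ℝ) * powBot d (D i j)⌋₊) ∧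
        ∀ h h', H.Adj h h' → ¬ NonAdjacent G (A h) (A h')}.ncard : ℝ) ≤
      Real.exp (-(κ₀ ^ 2 * t * d ^ (η ^ 2 / 4) / 32)) *
        ({H : SimpleGraph (Fin t) | ∀ i j, edgesBetween H (block s t i) (block s t j) =
          ⌊(t : ℝ) * powBot d (D i j)⌋₊}.ncard : ℝ) := by
  have hd0 : 0 < d := by linarith
  have htR : (0 : ℝ) < t := by exact_mod_cast ht
  set S : Fin r → Finset (Fin t) := fun i => Finset.univ.filter fun v => v ∈ block s t i with hSdef
  have hScard : ∀ i, (S i).card = s i := card_block hs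
  have hSdis : Pairwise fun i j => Disjoint (S i) (S j) := by
    intro i j hij
    rw [Finset.disjoint_left]
    intro v hv hv'
    exact Set.disjoint_left.1 (disjoint_block s t hij) (Finset.mem_filter.1 hv).2
      (Finset.mem_filter.1 hv').2
  have hnpos : (0 : ℝ) < n := by exact_mod_cast (Nat.zero_le _).trans_lt hn
  have hS0 : ∀ i, 0 < (S i).card := by
    intro i
    rw [hScard]
    have := hns i
    rcases Nat.eq_zero_or_pos (s i) with h | h
    · rw [h] at this
      norm_num at this
      linarith
    · exact h
  have hAsum : (∑ h, ((A h).card : ℝ)) ≤ m * b := by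
    have := sum_card_le_of_card_filter_mem_le hA
    rw [Fintype.card_fin] at this
    exact_mod_cast this
  obtain ⟨i, j, a, x, y, haD, ha1, hx, hy, hxy, hPi, hQj⟩ := exists_light_blocks
    (w := fun h => ((A h).card : ℝ) / L) (c := c) (η := η) hσ hD hSdis hS0
    (fun h => by positivity) hη hc (by simpa only [hScard] using hσs) (by
      refine lt_of_le_of_lt ?_ hγ
      rw [← Finset.sum_div]
      gcongr)
  rw [hScard] at hPi hQj
  obtain ⟨P, hP, Q, hQ, hPQ, hPn, hQn⟩ := exists_disjoint_subsets_card_eq (n := n)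
    (by have := (hns i).trans hPi; exact_mod_cast this)
    (by have := (hns j).trans hQj; exact_mod_cast this)
  have hwx : ∀ h ∈ P, ((A h).card : ℝ) ≤ x * L := fun h hh =>
    (div_le_iff₀ hL0).1 (Finset.mem_filter.1 (hP hh)).2
  have hwy : ∀ h ∈ Q, ((A h).card : ℝ) ≤ y * L := fun h hh =>
    (div_le_iff₀ hL0).1 (Finset.mem_filter.1 (hQ hh)).2
  have hsize : ∀ z : ℝ, z * η ≤ 2 → ∀ h, ((A h).card : ℝ) ≤ z * L → (A h).card ≤ k := by
    intro z hz h hh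
    have h1 : z * L ≤ 2 * L / η := by
      rw [le_div_iff₀ hη]
      nlinarith
    have : ((A h).card : ℝ) < k + 1 := by linarith
    exact Nat.lt_succ_iff.1 (by exact_mod_cast this)
  obtain ⟨ha0, hx2, hy2, hxya⟩ := threshold_bounds hη hx hy hxy ha1
  have hmult : ∀ (R : Finset (Fin t)) v, (R.filter fun h => v ∈ A h).card ≤ b := fun R v =>
    (Finset.card_le_card (Finset.filter_subset_filter _ (Finset.subset_univ R))).trans (hA v)
  have hcount := card_nonAdjacent_ge (ρ := d ^ (η ^ 2 / 4 - a)) hG (A := A) (P := P) (Q := Q) hN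
    (fun h hh => hsize x hx2 h (hwx h hh)) (fun h hh => hsize y hy2 h (hwy h hh))
    (hmult P) (hmult Q) (by omega) (by omega) (by positivity)
    (Real.rpow_le_rpow_of_exponent_le hd.le (by linarith)) (fun h hh h' hh' => by
      have : η ^ 2 / 4 - a = -(a - η ^ 2 / 4) := by ring
      rw [this]
      refine rpow_neg_le_pow_of_le hd hq hq1 hL ?_
      push_cast
      calc ((A h).card : ℝ) * (A h').card ≤ (x * L) * (y * L) :=
            mul_le_mul (hwx h hh) (hwy h' hh') (Nat.cast_nonneg _) (by positivity)
        _ = (x * y) * L ^ 2 := by ring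
        _ ≤ _ := by gcongr)
  rw [hPn, hQn] at hcount
  set Z := (P ×ˢ Q).filter fun c => NonAdjacent G (A c.1) (A c.2) with hZ
  have hZmem : ∀ c ∈ Z, c.1 ∈ P ∧ c.2 ∈ Q ∧ NonAdjacent G (A c.1) (A c.2) := by
    intro c hc
    obtain ⟨h1, h2⟩ := Finset.mem_filter.1 hc
    exact ⟨(Finset.mem_product.1 h1).1, (Finset.mem_product.1 h1).2, h2⟩
  have hPS : ∀ h ∈ P, h ∈ block s t i := fun h hh =>
    (Finset.mem_filter.1 (Finset.mem_filter.1 (hP hh)).1).2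
  have hQS : ∀ h ∈ Q, h ∈ block s t j := fun h hh =>
    (Finset.mem_filter.1 (Finset.mem_filter.1 (hQ hh)).1).2
  have havoid := ncard_avoiding_le (disjoint_block s t)
    (κ := fun i j => ⌊(t : ℝ) * powBot d (D i j)⌋₊) (fun i j => by rw [hD.1 i j]) i j (Z := Z)
    (fun c hc => ⟨hPS _ (hZmem c hc).1, hQS _ (hZmem c hc).2.1, fun h =>
      Finset.disjoint_left.1 hPQ (hZmem c hc).1 (h ▸ (hZmem c hc).2.1)⟩)
    (by
      intro c hc c' hc' h
      rcases Sym2.eq_iff.1 h with ⟨h1, h2⟩ | ⟨h1, h2⟩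
      · exact Prod.ext h1 h2
      · exact absurd (h1 ▸ (hZmem c hc).1) fun h' =>
          Finset.disjoint_left.1 hPQ h' (hZmem c' hc').2.1)
  refine le_trans ?_ (havoid.trans ?_)
  · refine Nat.cast_le.2 (Set.ncard_le_ncard ?_ (Set.toFinite _))
    rintro H ⟨h1, h2⟩
    exact ⟨h1, fun c hc hadj => h2 _ _ hadj (hZmem c hc).2.2⟩
  · refine mul_le_mul_of_nonneg_right (Real.exp_le_exp.2 (neg_le_neg ?_)) (Nat.cast_nonneg _)
    have hpow : powBot d (D i j) = d ^ a := by rw [haD]; rfl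
    have h1 : (1 : ℝ) ≤ t * d ^ a := by
      have h2 : (1 : ℝ) ≤ t := by exact_mod_cast ht
      have h3 := Real.one_le_rpow hd.le ha0.le
      exact one_le_mul_of_one_le_of_one_le h2 h3
    have hK := half_le_natFloor h1
    simp only [hpow, Fintype.card_fin]
    have hprod : d ^ a * d ^ (η ^ 2 / 4 - a) = d ^ (η ^ 2 / 4) := by
      rw [← Real.rpow_add hd0]; congr 1; ring
    calc κ₀ ^ 2 * t * d ^ (η ^ 2 / 4) / 32
        = (t * d ^ a / 2) * ((d ^ (η ^ 2 / 4 - a) * (κ₀ * t) * (κ₀ * t) / 16) / (t : ℝ) ^ 2) := by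
          rw [← hprod]; field_simp; ring
      _ ≤ (⌊(t : ℝ) * d ^ a⌋₊ : ℝ) *
          ((d ^ (η ^ 2 / 4 - a) * n * n / 16) / (t : ℝ) ^ 2) := by
          gcongr
      _ ≤ _ := by gcongr

lemma ncard_biUnion_le_mul {ι β : Type*} [Finite β] {s : Finset ι} {f : ι → Set β} {B : ℝ}
    (h : ∀ i ∈ s, ((f i).ncard : ℝ) ≤ B) : ((⋃ i ∈ s, f i).ncard : ℝ) ≤ s.card * B := by
  induction s using Finset.induction_on with
  | empty => simp
  | insert i s hi ih =>
    rw [Finset.set_biUnion_insert, Finset.card_insert_of_notMem hi]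
    have h1 : ((f i ∪ ⋃ j ∈ s, f j).ncard : ℝ) ≤ (f i).ncard + (⋃ j ∈ s, f j).ncard := by
      exact_mod_cast Set.ncard_union_le _ _
    have h2 := ih fun j hj => h j (Finset.mem_insert_of_mem hj)
    have h3 := h i (Finset.mem_insert_self i s)
    push_cast
    linarith

/-- Union bound over the projections of the branch sets, for which there are at most
`exp t * m ^ (m * b)` possibilities, and over the parameter `i₀` of the block sizes. -/
theorem ncard_minors_of_blowUp_le {r m t N k b n : ℕ} {σ : Fin r → ℝ}
    {D : Fin r → Fin r → WithBot ℝ} (hσ : IsWeightVector σ) (hD : IsExponentMatrix D)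
    {d q L η c κ₀ : ℝ} (hd : 1 < d) (ht : 0 < t) (hm : 0 < m) (hq : 0 < q) (hq1 : q < 1)
    (hL0 : 0 < L) (hL : L ^ 2 * -Real.log q = Real.log d) (hη : 0 < η) {G : SimpleGraph (Fin m)}
    (hG : HasManyNonAdjacentPairs G q (d ^ (η ^ 2 / 4 - 1)) N k) (hN : 0 < N)
    (hk : 2 * L / η < k + 1) (hc : 0 ≤ c)
    (hσs : ∀ i₀ i, σ i ≤ c * partSize σ t i₀ i)
    (hγ : c * (m * b / L) + η < gammaParam σ D) (hn : 4 * (N * k * b) < n)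
    (hns : ∀ i₀ i, 2 * (n : ℝ) ≤ η ^ 2 / 2 * partSize σ t i₀ i) (hκ₀ : 0 ≤ κ₀)
    (hκn : κ₀ * t ≤ n) :
    ({H ∈ graphClass σ D t d | IsMinor H (blowUp G b)}.ncard : ℝ) ≤
      (r + 1) * (Real.exp t * (m : ℝ) ^ (m * b)) *
        (Real.exp (-(κ₀ ^ 2 * t * d ^ (η ^ 2 / 4) / 32)) * ((graphClass σ D t d).ncard : ℝ)) := by
  set 𝒜 : Finset (Fin t → Finset (Fin m)) := Finset.univ.filter fun A =>
    ∀ v, (Finset.univ.filter fun h => v ∈ A h).card ≤ b with h𝒜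
  have h𝒜card : (𝒜.card : ℝ) ≤ Real.exp t * (m : ℝ) ^ (m * b) := by
    have := card_families_le (ι := Fin t) (V := Fin m) (by simpa using hm) (m * b)
    simp only [Fintype.card_fin] at this
    refine le_trans (Nat.cast_le.2 (Finset.card_le_card fun A hA => ?_)) this
    have := sum_card_le_of_card_filter_mem_le (Finset.mem_filter.1 hA).2
    rw [Fintype.card_fin] at this
    exact Finset.mem_filter.2 ⟨Finset.mem_univ _, this⟩
  set cls : ℕ → Set (SimpleGraph (Fin t)) := fun i₀ => {H | ∀ i j,
    edgesBetween H (block (partSize σ t i₀) t i) (block (partSize σ t i₀) t j) =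
      ⌊(t : ℝ) * powBot d (D i j)⌋₊} with hcls
  set f : ℕ × (Fin t → Finset (Fin m)) → Set (SimpleGraph (Fin t)) := fun x =>
    {H | ∑ i, partSize σ t x.1 i = t ∧ H ∈ cls x.1 ∧
      ∀ h h', H.Adj h h' → ¬ NonAdjacent G (x.2 h) (x.2 h')} with hf
  have hsub : {H ∈ graphClass σ D t d | IsMinor H (blowUp G b)} ⊆
      ⋃ x ∈ Finset.range (r + 1) ×ˢ 𝒜, f x := by
    rintro H ⟨⟨i₀, hi₀, hsum, hH⟩, hmin⟩
    obtain ⟨A, hA, hadj⟩ := exists_projections_of_isMinor_blowUp hmin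
    refine Set.mem_iUnion₂.2 ⟨(i₀, A), Finset.mem_product.2 ⟨?_, ?_⟩, hsum, hH, hadj⟩
    · exact Finset.mem_range.2 (Nat.lt_succ_of_le hi₀)
    · exact Finset.mem_filter.2 ⟨Finset.mem_univ _, hA⟩
  have hbound : ∀ x ∈ Finset.range (r + 1) ×ˢ 𝒜, ((f x).ncard : ℝ) ≤
      Real.exp (-(κ₀ ^ 2 * t * d ^ (η ^ 2 / 4) / 32)) * ((graphClass σ D t d).ncard : ℝ) := by
    rintro ⟨i₀, A⟩ hx
    obtain ⟨hi₀, hA⟩ := Finset.mem_product.1 hx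
    by_cases hsum : ∑ i, partSize σ t i₀ i = t
    · have h1 := ncard_compatible_le hσ hD hsum hd ht hq hq1 hL0 hL hη hG hN hk hc (hσs i₀) hγ hn
        (hns i₀) hκ₀ hκn (Finset.mem_filter.1 hA).2
      refine le_trans (Nat.cast_le.2 (Set.ncard_le_ncard ?_ (Set.toFinite _))) (h1.trans ?_)
      · rintro H ⟨-, h2, h3⟩
        exact ⟨h2, h3⟩
      refine mul_le_mul_of_nonneg_left (Nat.cast_le.2 (Set.ncard_le_ncard ?_ (Set.toFinite _)))
        (Real.exp_pos _).le
      intro H hH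
      exact ⟨i₀, Nat.lt_succ_iff.1 (Finset.mem_range.1 hi₀), hsum, hH⟩
    · have : f (i₀, A) = ∅ := by
        ext H
        simp [hf, hsum]
      rw [this]
      simp only [Set.ncard_empty, Nat.cast_zero]
      positivity
  refine le_trans (Nat.cast_le.2 (Set.ncard_le_ncard hsub (Set.toFinite _)))
    ((ncard_biUnion_le_mul hbound).trans ?_)
  rw [Finset.card_product, Finset.card_range]
  push_cast
  gcongr

/-! ### Choice of the parameters -/

/-- The bound on the density of the blow-up in terms of the optimal edge probability. -/
lemma density_bound {α' ε θ p f lam L lg γ t m b e : ℝ} (hm : 0 < m) (hb : 0 < b) (hθ : 0 < θ)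
    (hθ1 : 4 * θ ≤ 1) (hθf : 8 * f * θ ≤ ε) (hp : 0 < p) (hlam : 0 < lam)
    (hf : f = p / (2 * √lam)) (hfα : α' - ε / 2 ≤ f) (hL : L = √lg / √lam) (hγ : 0 < γ)
    (ht : 0 < t) (hbl : (1 - 2 * θ) * (γ * t * L / m) ≤ b) (hm1 : (1 - θ) * m ≤ m - 1)
    (he : (1 - θ) * p * (m * (m - 1) / 2) ≤ e) :
    (α' - ε) * γ * t * √lg ≤ b ^ 2 * e / (m * b) := by
  have hs : 0 < √lam := Real.sqrt_pos.2 hlam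
  have hlg : 0 ≤ √lg := Real.sqrt_nonneg _
  have hL0 : 0 ≤ L := by rw [hL]; positivity
  have hf0 : 0 < f := by rw [hf]; positivity
  have h1 : b ^ 2 * e / (m * b) = b * (e / m) := by field_simp
  have h2 : (1 - θ) * p * ((1 - θ) * m) / 2 ≤ e / m := by
    rw [le_div_iff₀ hm]
    refine le_trans ?_ he
    have : 0 ≤ (1 - θ) * p * m / 2 := by
      have : 0 ≤ 1 - θ := by linarith
      positivity
    have := mul_le_mul_of_nonneg_left hm1 this
    linarith
  have hpL : p * L = 2 * f * √lg := by
    rw [hf, hL]; field_simp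
  have hX : 0 ≤ γ * t * √lg := by positivity
  have hfθ : α' - ε ≤ (1 - 2 * θ) * (1 - θ) ^ 2 * f := by
    have h3 : 1 - 4 * θ ≤ (1 - 2 * θ) * (1 - θ) ^ 2 := by nlinarith [sq_nonneg θ]
    have := mul_le_mul_of_nonneg_right h3 hf0.le
    linarith
  have h2θ : 0 ≤ 1 - 2 * θ := by linarith
  have h1θ : 0 ≤ 1 - θ := by linarith
  calc (α' - ε) * γ * t * √lg = (α' - ε) * (γ * t * √lg) := by ring
    _ ≤ ((1 - 2 * θ) * (1 - θ) ^ 2 * f) * (γ * t * √lg) := by gcongr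
    _ = ((1 - 2 * θ) * (γ * t / m)) * ((1 - θ) * ((1 - θ) * m) / 2) * (2 * f * √lg) := by
        field_simp
    _ = ((1 - 2 * θ) * (γ * t * L / m)) * ((1 - θ) * p * ((1 - θ) * m) / 2) := by
        rw [← hpL]; ring
    _ ≤ b * (e / m) := by gcongr
    _ = _ := h1.symm

lemma eventually_const_mul_log_pow_le (C : ℝ) {δ : ℝ} (hδ : 0 < δ) (k : ℕ) :
    ∀ᶠ d : ℝ in atTop, C * Real.log d ^ k ≤ d ^ δ := by
  have h := (isLittleO_log_rpow_rpow_atTop (k : ℝ) hδ).bound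
    (c := 1 / (|C| + 1)) (by positivity)
  filter_upwards [h, eventually_ge_atTop 1] with d hd hd1
  have hlog : 0 ≤ Real.log d := Real.log_nonneg hd1
  rw [Real.rpow_natCast, Real.norm_of_nonneg (by positivity),
    Real.norm_of_nonneg (by positivity)] at hd
  have hC : C ≤ |C| + 1 := by linarith [le_abs_self C]
  calc C * Real.log d ^ k ≤ (|C| + 1) * Real.log d ^ k := by gcongr
    _ ≤ (|C| + 1) * (1 / (|C| + 1) * d ^ δ) := by gcongr
    _ = d ^ δ := by field_simp

/-- Existence of the pseudo-random graph with the parameters used for the blow-up. -/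
lemma exists_pseudorandom_graph {q θ δ c₁ η d L : ℝ} {m : ℕ} (hq0 : 0 < q) (hq1 : q < 1)
    (hθ : θ ≤ 1) (hm : 2 ≤ m) (hmd : (m : ℝ) ≤ d) (hd : 1 < d)
    (hlog : 0 < Real.log d) (hL : 0 ≤ L) (hη : 0 < η)
    (hN1 : 1 ≤ c₁ * d / Real.log d) (hN2 : Real.exp (1 - c₁ * d / Real.log d) < θ * (1 - q))
    (hmain : 3 + 4 * L / η * Real.log d ≤ c₁ * d ^ δ / (8 * Real.log d)) :
    ∃ G : SimpleGraph (Fin m), (1 - θ) * (1 - q) * (m * (m - 1) / 2) ≤ (G.edgeSet.ncard : ℝ) ∧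
      HasManyNonAdjacentPairs G q (d ^ (δ - 1)) ⌊c₁ * d / Real.log d⌋₊ ⌊2 * L / η⌋₊ := by
  set N := ⌊c₁ * d / Real.log d⌋₊ with hN
  set k := ⌊2 * L / η⌋₊ with hk
  refine exists_hasManyNonAdjacentPairs hq0 hq1 hθ hm (lt_of_le_of_lt ?_ hN2)
  have hm0 : (0 : ℝ) < m := by exact_mod_cast (by omega : 0 < m)
  have hd0 : 0 < d := by linarith
  have hkle : (k : ℝ) ≤ 2 * L / η := Nat.floor_le (by positivity)
  have hNlow := half_le_natFloor hN1
  have hNlow' : c₁ * d / Real.log d - 1 ≤ N := (Nat.sub_one_lt_floor _).le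
  have hmpow : (m : ℝ) ^ (2 * N * k) = Real.exp (2 * N * k * Real.log m) := by
    rw [pow_eq_exp_mul_log hm0]; push_cast; rfl
  rw [hmpow, ← Real.exp_add, ← Real.exp_add]
  refine Real.exp_le_exp.2 ?_
  have hlogm : Real.log m ≤ Real.log d := Real.log_le_log hm0 hmd
  have hlogm0 : 0 ≤ Real.log m := Real.log_nonneg (by exact_mod_cast (by omega : 1 ≤ m))
  have h1 : 2 * k * Real.log m ≤ 4 * L / η * Real.log d := by
    calc 2 * k * Real.log m ≤ 2 * (2 * L / η) * Real.log d := by gcongr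
      _ = _ := by ring
  have hrpow : d ^ (δ - 1) * d = d ^ δ := by
    rw [Real.rpow_sub hd0, Real.rpow_one]; field_simp
  have h2 : c₁ * d ^ δ / (8 * Real.log d) ≤ d ^ (δ - 1) * N / 4 := by
    calc c₁ * d ^ δ / (8 * Real.log d) = d ^ (δ - 1) * (c₁ * d / Real.log d / 2) / 4 := by
          rw [← hrpow]; field_simp; ring
      _ ≤ _ := by gcongr
  have h3 : 2 + 2 * k * Real.log m - d ^ (δ - 1) * N / 4 ≤ -1 := by linarith
  have hN0 : (0 : ℝ) ≤ N := Nat.cast_nonneg _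
  calc 2 * (N : ℝ) + 2 * N * k * Real.log m + -(d ^ (δ - 1) * (N : ℝ) ^ 2 / 4)
      = N * (2 + 2 * k * Real.log m - d ^ (δ - 1) * N / 4) := by ring
    _ ≤ N * (-1) := mul_le_mul_of_nonneg_left h3 hN0
    _ ≤ _ := by linarith

/-- The union bound is beaten by the probability `exp (-κ₀² t d ^ δ / 32)`. -/
lemma union_bound_le {r t m b : ℕ} {ε d L κ₀ δ X : ℝ} (hε : 0 < ε) (hr : r * ε ≤ 1) (ht : 1 / ε ≤ t)
    (hm : 0 < m) (hmd : (m : ℝ) ≤ d) (hmb : (m * b : ℝ) ≤ t * L) (hd : 1 < d) (hX : 0 ≤ X)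
    (hmain : 3 + L * Real.log d ≤ κ₀ ^ 2 * d ^ δ / 32) :
    (r + 1) * (Real.exp t * (m : ℝ) ^ (m * b)) * (Real.exp (-(κ₀ ^ 2 * t * d ^ δ / 32)) * X) ≤
      (2 : ℝ) ^ (-(t : ℝ)) * X := by
  have hm0 : (0 : ℝ) < m := by exact_mod_cast hm
  have hlog : 0 ≤ Real.log d := Real.log_nonneg hd.le
  have hrt : (r : ℝ) ≤ t := by
    rw [← le_div_iff₀ hε] at hr
    linarith
  have h1 : (r : ℝ) + 1 ≤ Real.exp t := by
    linarith [Real.add_one_le_exp (t : ℝ)]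
  have h2 : (m : ℝ) ^ (m * b) ≤ Real.exp (t * L * Real.log d) := by
    rw [pow_eq_exp_mul_log hm0]
    refine Real.exp_le_exp.2 ?_
    push_cast
    calc (m * b : ℝ) * Real.log m ≤ (m * b : ℝ) * Real.log d := by
          gcongr
      _ ≤ t * L * Real.log d := by gcongr
  have h3 : Real.exp (-t) ≤ (2 : ℝ) ^ (-(t : ℝ)) := by
    rw [Real.rpow_def_of_pos two_pos]
    refine Real.exp_le_exp.2 ?_
    have : Real.log 2 ≤ 1 := by linarith [Real.log_two_lt_d9]
    nlinarith [(Nat.cast_nonneg t : (0 : ℝ) ≤ t)]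
  calc (r + 1) * (Real.exp t * (m : ℝ) ^ (m * b)) *
        (Real.exp (-(κ₀ ^ 2 * t * d ^ δ / 32)) * X)
      ≤ Real.exp t * (Real.exp t * Real.exp (t * L * Real.log d)) *
        (Real.exp (-(κ₀ ^ 2 * t * d ^ δ / 32)) * X) := by gcongr
    _ = Real.exp (t * (2 + L * Real.log d - κ₀ ^ 2 * d ^ δ / 32)) * X := by
        rw [← mul_assoc, ← Real.exp_add, ← Real.exp_add, ← Real.exp_add]
        congr 2; ring
    _ ≤ Real.exp (-t) * X := by
        gcongr
        nlinarith [(Nat.cast_nonneg t : (0 : ℝ) ≤ t)]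
    _ ≤ _ := by gcongr

/-- All conditions on `d` that are needed for the construction, for `d` large. -/
lemma eventually_numeric_conditions {ε θ η κ₀ c₁ lam P : ℝ} (hε : 0 < ε) (hθ0 : 0 < θ) (hη0 : 0 < η)
    (hκ0 : 0 < κ₀) (hc0 : 0 < c₁) (hlam0 : 0 < lam) (hP : 0 < P) :
    ∀ᶠ d : ℝ in atTop, (2 ≤ d ∧ 1 / θ + 1 ≤ d ∧ (2 / θ + 2) / ε ≤ d ∧ 1 / κ₀ ≤ d) ∧
      1 ≤ θ * ε * (√(Real.log d) / √lam) ∧ 1 ≤ c₁ * d / Real.log d ∧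
      Real.exp (1 - c₁ * d / Real.log d) < P ∧
      3 + 4 * (√(Real.log d) / √lam) / η * Real.log d ≤
        c₁ * d ^ (η ^ 2 / 4) / (8 * Real.log d) ∧
      3 + √(Real.log d) / √lam * Real.log d ≤ κ₀ ^ 2 * d ^ (η ^ 2 / 4) / 32 := by
  have hsl : 0 < √lam := Real.sqrt_pos.2 hlam0
  have hδ : 0 < η ^ 2 / 4 := by positivity
  have hlogtop := Real.tendsto_log_atTop
  filter_upwards [eventually_ge_atTop 2, eventually_ge_atTop (1 / θ + 1),
    eventually_ge_atTop ((2 / θ + 2) / ε), eventually_ge_atTop (1 / κ₀),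
    hlogtop.eventually_ge_atTop 1, hlogtop.eventually_ge_atTop ((√lam / (θ * ε)) ^ 2),
    eventually_const_mul_log_pow_le (8 * (3 + 4 / (η * √lam)) / c₁) hδ 3,
    eventually_const_mul_log_pow_le (32 * (3 + 1 / √lam) / κ₀ ^ 2) hδ 2,
    eventually_const_mul_log_pow_le ((max 1 (2 - Real.log P)) / c₁) one_pos 1]
    with d hd2 hdθ hdε hdκ hlog1 hlogθ hC1 hC2 hC3
  have hd0 : 0 < d := by linarith
  have hlog0 : 0 < Real.log d := by linarith
  set L : ℝ := √(Real.log d) / √lam with hLdef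
  have hL0 : 0 < L := div_pos (Real.sqrt_pos.2 hlog0) hsl
  have hLlog : L ≤ Real.log d / √lam := by
    have h : √(Real.log d) ≤ Real.log d := Real.sqrt_le_left hlog0.le |>.2 (by nlinarith)
    rw [hLdef]
    gcongr
  have hθεL : 1 ≤ θ * ε * L := by
    have h := Real.le_sqrt_of_sq_le hlogθ
    rw [div_le_iff₀ (by positivity)] at h
    rw [hLdef, mul_div_assoc', le_div_iff₀ hsl]
    linarith
  have hx : max 1 (2 - Real.log (P)) ≤ c₁ * d / Real.log d := by
    rw [pow_one, Real.rpow_one, div_mul_eq_mul_div, div_le_iff₀ hc0] at hC3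
    rw [le_div_iff₀ hlog0]
    linarith
  have hN1 : 1 ≤ c₁ * d / Real.log d := (le_max_left _ _).trans hx
  have hN2 : Real.exp (1 - c₁ * d / Real.log d) < P := by
    rw [← Real.lt_log_iff_exp_lt (by positivity)]
    linarith [(le_max_right _ _).trans hx]
  have hmain1 : 3 + 4 * L / η * Real.log d ≤ c₁ * d ^ (η ^ 2 / 4) / (8 * Real.log d) := by
    rw [div_mul_eq_mul_div, div_le_iff₀ hc0] at hC1
    rw [le_div_iff₀ (by positivity)]
    have h1 : 3 + 4 * L / η * Real.log d ≤ (3 + 4 / (η * √lam)) * Real.log d ^ 2 := by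
      have h2 : 4 * L / η * Real.log d ≤ 4 * (Real.log d / √lam) / η * Real.log d := by gcongr
      have h3 : 4 * (Real.log d / √lam) / η * Real.log d =
          4 / (η * √lam) * Real.log d ^ 2 := by field_simp
      have h4 : 1 ≤ Real.log d ^ 2 := one_le_pow₀ hlog1
      linarith
    calc _ ≤ (3 + 4 / (η * √lam)) * Real.log d ^ 2 * (8 * Real.log d) := by gcongr
      _ = 8 * (3 + 4 / (η * √lam)) * Real.log d ^ 3 := by ring
      _ ≤ _ := by linarith
  have hmain2 : 3 + L * Real.log d ≤ κ₀ ^ 2 * d ^ (η ^ 2 / 4) / 32 := by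
    rw [div_mul_eq_mul_div, div_le_iff₀ (by positivity)] at hC2
    have h2 : L * Real.log d ≤ Real.log d / √lam * Real.log d := by gcongr
    have h3 : Real.log d / √lam * Real.log d = 1 / √lam * Real.log d ^ 2 := by field_simp
    have h4 : 1 ≤ Real.log d ^ 2 := one_le_pow₀ hlog1
    rw [le_div_iff₀ (by norm_num)]
    nlinarith
  exact ⟨⟨hd2, hdθ, hdε, hdκ⟩, hθεL, hN1, hN2, hmain1, hmain2⟩

lemma threshold_sum_lt {θ ε γ : ℝ} (hθ : 0 < θ) (hε : 0 < ε) (hγ : ε ≤ γ) :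
    (1 + θ / 2) * (1 - θ) * γ + θ * ε / 4 < γ := by
  have h1 := mul_pos hθ (hε.trans_le hγ)
  nlinarith [mul_le_mul_of_nonneg_left hγ hθ.le, mul_pos hθ h1]

lemma four_mul_lt {N k b t m L η κ₀ c₁ d lg lam : ℝ} (hm : 0 < m) (ht : 0 < t) (hη : 0 < η)
    (hκ : 0 < κ₀) (hlg : 0 < lg) (hL : L ^ 2 * lam = lg) (hc₁ : c₁ = κ₀ * η * lam / 32)
    (hdm : d ≤ 2 * m) (hN : N ≤ c₁ * d / lg) (hk : k ≤ 2 * L / η) (hb : b ≤ t * L / m)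
    (hk0 : 0 ≤ k) (hb0 : 0 ≤ b) (hL0 : 0 < L) (hc0 : 0 < c₁) (hd : 0 < d) :
    4 * (N * k * b) < κ₀ * t := by
  have hκt := mul_pos hκ ht
  have hlam : lam ≠ 0 := by
    rintro rfl
    simp at hL
    linarith
  calc 4 * (N * k * b)
      ≤ 4 * ((c₁ * d / lg) * (2 * L / η) * (t * L / m)) := by gcongr
    _ = 8 * c₁ * t * L ^ 2 / (η * lg) * (d / m) := by field_simp; ring
    _ ≤ 8 * c₁ * t * L ^ 2 / (η * lg) * 2 := by
        gcongr
        rw [div_le_iff₀ hm]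
        exact hdm
    _ = κ₀ * t / 2 := by
        rw [← hL, hc₁]
        field_simp
        ring
    _ < κ₀ * t := by linarith

/-- The bound on the proportion of exceptional graphs, for an edge probability `p` and under explicit
conditions on `d`. -/
theorem ncard_not_le_minorExtremal_le {ε p q lam f θ η κ₀ c₁ d L α' : ℝ} {t r : ℕ} {σ : Fin r → ℝ}
    {D : Fin r → Fin r → WithBot ℝ} (hε : 0 < ε) (hp0 : 0 < p) (hq0 : 0 < q) (hpq : p = 1 - q)
    (hlam : lam = -Real.log q) (hf : f = p / (2 * √lam)) (hα : α' - ε / 2 ≤ f)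
    (hθ0 : 0 < θ) (hθ1 : 4 * θ ≤ 1) (hθf : 8 * f * θ ≤ ε) (hη : η = θ * ε / 4)
    (hκ₀ : κ₀ = ε * η ^ 2 / 16) (hc₁ : c₁ = κ₀ * η * lam / 32)
    (hLdef : L = √(Real.log d) / √lam) (hd2 : 2 ≤ d) (hdθ : 1 / θ + 1 ≤ d)
    (hdε : (2 / θ + 2) / ε ≤ d) (hdκ : 1 / κ₀ ≤ d) (hθεL : 1 ≤ θ * ε * L)
    (hN1 : 1 ≤ c₁ * d / Real.log d) (hN2 : Real.exp (1 - c₁ * d / Real.log d) < θ * (1 - q))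
    (hmain1 : 3 + 4 * L / η * Real.log d ≤ c₁ * d ^ (η ^ 2 / 4) / (8 * Real.log d))
    (hmain2 : 3 + L * Real.log d ≤ κ₀ ^ 2 * d ^ (η ^ 2 / 4) / 32) (hdt : d < t)
    (hσ : IsWeightVector σ) (hσε : ∀ i, ε < σ i) (hD : IsExponentMatrix D)
    (hγε : ε ≤ gammaParam σ D) :
    ({H ∈ graphClass σ D t d |
        ¬ (((α' - ε) * gammaParam σ D * (t : ℝ) * √(Real.log d) : ℝ) : EReal)
          ≤ minorExtremal H}.ncard : ℝ) ≤
      (2 : ℝ) ^ (-(t : ℝ)) * ((graphClass σ D t d).ncard : ℝ) := by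
  have hq1 : q < 1 := by linarith
  have hlam0 : 0 < lam := hlam ▸ neg_pos.2 (Real.log_neg hq0 hq1)
  have hsl : 0 < √lam := Real.sqrt_pos.2 hlam0
  have hη0 : 0 < η := by rw [hη]; positivity
  have hκ0 : 0 < κ₀ := by rw [hκ₀]; positivity
  have hc0 : 0 < c₁ := by rw [hc₁]; positivity
  set γ := gammaParam σ D with hγdef
  have hγ1 : γ ≤ 1 := gammaParam_le_one hσ hD
  have hγ0 : 0 < γ := hε.trans_le hγε
  have hd1 : 1 < d := by linarith
  have hd0 : 0 < d := by linarith
  have hlog0 : 0 < Real.log d := Real.log_pos hd1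
  have ht0R : (0 : ℝ) < t := by linarith
  have ht0 : 0 < t := by exact_mod_cast ht0R
  have hL0 : 0 < L := hLdef ▸ div_pos (Real.sqrt_pos.2 hlog0) hsl
  have hL : L ^ 2 * lam = Real.log d := by
    rw [hLdef, div_pow, Real.sq_sqrt hlog0.le, Real.sq_sqrt hlam0.le]
    field_simp
  set m : ℕ := ⌊d⌋₊ with hmdef
  have hm2 : 2 ≤ m := Nat.le_floor (by exact_mod_cast hd2)
  have hm0 : 0 < m := by omega
  have hm0R : (0 : ℝ) < m := by exact_mod_cast hm0
  have hmd : (m : ℝ) ≤ d := Nat.floor_le hd0.le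
  have hdm : d < m + 1 := Nat.lt_floor_add_one d
  have hd2m : d ≤ 2 * m := by
    have : (2 : ℝ) ≤ m := by exact_mod_cast hm2
    linarith
  have hθm : (1 - θ) * m ≤ m - 1 := by
    have h : 1 / θ ≤ m := by linarith
    rw [div_le_iff₀ hθ0] at h
    linarith
  -- The blow-up is to have slightly fewer than `γ * t * L` vertices.
  set B : ℝ := (1 - θ) * γ * t * L / m with hBdef
  have h1θ : 0 < 1 - θ := by linarith
  have hB0 : 0 ≤ B := by positivity
  set b : ℕ := ⌊B⌋₊ with hbdef
  have hbB : (b : ℝ) ≤ B := Nat.floor_le hB0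
  have hbl : (1 - 2 * θ) * (γ * t * L / m) ≤ b := by
    have h1 : B - 1 < b := Nat.sub_one_lt_floor B
    have h2 : 1 ≤ θ * (γ * t * L / m) := by
      have h3 : 1 ≤ (t : ℝ) / m := (one_le_div hm0R).2 (by linarith)
      have h4 : 1 ≤ θ * γ * L := hθεL.trans (by gcongr)
      calc (1 : ℝ) ≤ (θ * γ * L) * (t / m) := one_le_mul_of_one_le_of_one_le h4 h3
        _ = _ := by ring
    have h3 : B = (1 - θ) * (γ * t * L / m) := by rw [hBdef]; ring
    linarith
  have hb0R : (0 : ℝ) < b := by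
    refine lt_of_lt_of_le ?_ hbl
    have : 0 < 1 - 2 * θ := by linarith
    positivity
  have hb0 : 0 < b := by exact_mod_cast hb0R
  have hmb : (m * b : ℝ) ≤ (1 - θ) * γ * t * L := by
    rw [mul_comm, ← le_div_iff₀ hm0R]
    exact hbB
  have hmbL : (m * b : ℝ) ≤ t * L := by
    refine hmb.trans ?_
    have : (1 - θ) * γ ≤ 1 := mul_le_one₀ (by linarith) hγ0.le hγ1
    calc (1 - θ) * γ * t * L = ((1 - θ) * γ) * (t * L) := by ring
      _ ≤ 1 * (t * L) := by gcongr
      _ = t * L := one_mul _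
  obtain ⟨G, hGe, hG⟩ := exists_pseudorandom_graph (δ := η ^ 2 / 4) hq0 hq1
    (by linarith : θ ≤ 1) hm2 hmd hd1 hlog0 hL0.le hη0 hN1 hN2 hmain1
  set N : ℕ := ⌊c₁ * d / Real.log d⌋₊ with hN
  set k : ℕ := ⌊2 * L / η⌋₊ with hk
  have hN0 : 0 < N := Nat.floor_pos.2 hN1
  have htε : 2 / θ + 2 ≤ ε * t := by
    rw [div_le_iff₀ hε] at hdε
    linarith [mul_le_mul_of_nonneg_left hdt.le hε.le]
  have hs : ∀ i₀ i, ε * t - 1 ≤ (partSize σ t i₀ i : ℝ) := fun i₀ i => by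
    have := mul_le_mul_of_nonneg_right (hσε i).le ht0R.le
    linarith [le_partSize (σ := σ) t i₀ i]
  have h2θ : 0 < 2 / θ := by positivity
  -- Rounding the block sizes costs a factor of at most `1 + θ / 2`.
  have hσs : ∀ i₀ i, σ i ≤ (1 + θ / 2) / t * partSize σ t i₀ i := by
    intro i₀ i
    rw [div_mul_eq_mul_div, le_div_iff₀ ht0R]
    have h1 : 2 / θ ≤ (partSize σ t i₀ i : ℝ) := by linarith [hs i₀ i]
    rw [div_le_iff₀ hθ0] at h1
    linarith [le_partSize (σ := σ) t i₀ i]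
  have hκt : 1 ≤ κ₀ * t := by
    rw [div_le_iff₀ hκ0] at hdκ
    linarith [mul_le_mul_of_nonneg_left hdt.le hκ0.le]
  -- `N` sets of size `k` in families of multiplicity `b` must not exhaust `κ₀ * t` sets.
  have hn : 4 * (N * k * b) < ⌈κ₀ * t⌉₊ := by
    have h1 : (N : ℝ) ≤ c₁ * d / Real.log d := Nat.floor_le (by positivity)
    have h2 : (k : ℝ) ≤ 2 * L / η := Nat.floor_le (by positivity)
    have h3 : (b : ℝ) ≤ t * L / m := by
      rw [le_div_iff₀ hm0R, mul_comm]
      exact hmbL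
    have h4 := four_mul_lt hm0R ht0R hη0 hκ0 hlog0 (hlam ▸ hL) hc₁ hd2m h1 h2 h3
      (Nat.cast_nonneg k) (Nat.cast_nonneg b) hL0 hc0 hd0
    have h5 := h4.trans_le (Nat.le_ceil (κ₀ * (t : ℝ)))
    exact_mod_cast h5
  have hns : ∀ i₀ i, 2 * ((⌈κ₀ * t⌉₊ : ℕ) : ℝ) ≤ η ^ 2 / 2 * partSize σ t i₀ i := by
    intro i₀ i
    have h1 : ((⌈κ₀ * t⌉₊ : ℕ) : ℝ) < κ₀ * t + 1 := Nat.ceil_lt_add_one (by positivity)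
    have h2 : ε * t / 2 ≤ (partSize σ t i₀ i : ℝ) := by linarith [hs i₀ i]
    have h3 : η ^ 2 / 2 * (ε * t / 2) ≤ η ^ 2 / 2 * partSize σ t i₀ i := by gcongr
    have h4 : η ^ 2 / 2 * (ε * t / 2) = 4 * (κ₀ * t) := by rw [hκ₀]; ring
    linarith
  have hγlt : (1 + θ / 2) / t * (m * b / L) + η < gammaParam σ D := by
    have h1 : (m * b / L : ℝ) ≤ (1 - θ) * γ * t := by
      rw [div_le_iff₀ hL0]
      exact hmb
    have h2 : (1 + θ / 2) / t * (m * b / L) ≤ (1 + θ / 2) * (1 - θ) * γ := by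
      calc (1 + θ / 2) / t * (m * b / L) ≤ (1 + θ / 2) / t * ((1 - θ) * γ * t) := by gcongr
        _ = _ := by field_simp
    exact (add_le_add_left h2 η).trans_lt (hη ▸ threshold_sum_lt hθ0 hε hγε)
  have hbound := ncard_minors_of_blowUp_le (k := k) (b := b) hσ hD hd1 ht0 hm0 hq0 hq1 hL0
    (hlam ▸ hL) hη0 hG hN0 (Nat.lt_floor_add_one _) (by positivity) hσs hγlt hn hns hκ0.le (Nat.le_ceil _)
  have hr : (r : ℝ) * ε ≤ 1 := by
    rw [← hσ.2]
    calc (r : ℝ) * ε = ∑ _i : Fin r, ε := by simp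
      _ ≤ ∑ i, σ i := Finset.sum_le_sum fun i _ => (hσε i).le
  have ht1ε : 1 / ε ≤ t := by
    rw [div_le_iff₀ hε]
    linarith
  refine le_trans ?_ (hbound.trans (union_bound_le hε hr ht1ε hm0 hmd hmbL hd1
    (Nat.cast_nonneg _) hmain2))
  refine Nat.cast_le.2 (Set.ncard_le_ncard ?_ (Set.toFinite _))
  rintro H ⟨hH, hlow⟩
  refine ⟨hH, isMinor_of_not_le_minorExtremal hlow (Nat.mul_pos hm0 hb0) _ ?_⟩
  rw [ncard_edgeSet_blowUp]
  push_cast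
  exact density_bound hm0R hb0R hθ0 hθ1 hθf hp0 hlam0 hf hα hLdef hγ0 ht0R hbl hθm
    (by rw [hpq]; exact hGe)

end

theorem theorem1p11 (ε : ℝ) (hε : 0 < ε) :
    ∃ D₀ : ℝ, ∀ (t : ℕ) (d : ℝ), D₀ < d → d < (t : ℝ) →
      ∀ (r : ℕ) (σ : Fin r → ℝ) (D : Fin r → Fin r → WithBot ℝ),
        IsWeightVector σ → (∀ i, ε < σ i) → IsExponentMatrix D → ε ≤ gammaParam σ D →
        ({H ∈ graphClass σ D t d |
            ¬ (((alphaConst - ε) * gammaParam σ D * (t : ℝ) * Real.sqrt (Real.log d) : ℝ) : EReal)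
              ≤ minorExtremal H}.ncard : ℝ) ≤
          (2 : ℝ) ^ (-(t : ℝ)) * ((graphClass σ D t d).ncard : ℝ) := by
  obtain ⟨_, ⟨p, ⟨hp0, hp1⟩, rfl⟩, hpα⟩ : ∃ x ∈ (fun p : ℝ =>
      p / (2 * √(Real.log (1 / (1 - p))))) '' Set.Ioo 0 1, alphaConst - ε / 2 < x :=
    exists_lt_of_lt_csSup ⟨_, 1 / 2, by norm_num, rfl⟩ (show alphaConst - ε / 2 < alphaConst by
      linarith)
  have hq0 : 0 < 1 - p := by linarith
  have hlam0 : 0 < -Real.log (1 - p) := neg_pos.2 (Real.log_neg hq0 (by linarith))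
  simp only [one_div, Real.log_inv] at hpα
  set f : ℝ := p / (2 * √(-Real.log (1 - p))) with hf
  have hf0 : 0 < f := div_pos hp0 (mul_pos two_pos (Real.sqrt_pos.2 hlam0))
  obtain ⟨θ, hθ0, hθ1, hθf⟩ : ∃ θ : ℝ, 0 < θ ∧ 4 * θ ≤ 1 ∧ 8 * f * θ ≤ ε := by
    refine ⟨min (1 / 4) (ε / (8 * f)), by positivity, ?_, ?_⟩
    · linarith [min_le_left (1 / 4) (ε / (8 * f))]
    · have := min_le_right (1 / 4) (ε / (8 * f))
      rw [le_div_iff₀ (by positivity)] at this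
      linarith
  obtain ⟨η, hη⟩ : ∃ η, η = θ * ε / 4 := ⟨_, rfl⟩
  obtain ⟨κ₀, hκ₀⟩ : ∃ κ₀, κ₀ = ε * η ^ 2 / 16 := ⟨_, rfl⟩
  obtain ⟨c₁, hc₁⟩ : ∃ c₁, c₁ = κ₀ * η * -Real.log (1 - p) / 32 := ⟨_, rfl⟩
  have hη0 : 0 < η := by rw [hη]; positivity
  have hκ0 : 0 < κ₀ := by rw [hκ₀]; positivity
  have hc0 : 0 < c₁ := by rw [hc₁]; positivity
  obtain ⟨D₀, hD₀⟩ := Filter.eventually_atTop.1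
    (eventually_numeric_conditions hε hθ0 hη0 hκ0 hc0 hlam0 (mul_pos hθ0 hp0))
  refine ⟨D₀, fun t d hdD hdt r σ D hσ hσε hD hγε => ?_⟩
  obtain ⟨⟨hd2, hdθ, hdε, hdκ⟩, hθεL, hN1, hN2, hmain1, hmain2⟩ := hD₀ d hdD.le
  exact ncard_not_le_minorExtremal_le hε hp0 hq0 (by ring) rfl hf hpα.le hθ0 hθ1 hθf hη hκ₀ hc₁
    rfl hd2 hdθ hdε hdκ hθεL hN1 (by rwa [sub_sub_cancel]) hmain1 hmain2 hdt hσ hσε hD hγε
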